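/- Let $p_1=(a_1:b_1)\neq p_2=(a_2:b_2)$ be points of $\mathbb{CP}^1$ and let $\Gamma$ be the surface obtained from $\mathbb{CP}^1\times\mathbb{CP}^1$ by identifying $(p_1,t)\sim(t,p_2)$ for all $t\in\mathbb{CP}^1$. Let $f=\alpha z_1z_2+\beta z_1w_2+\gamma z_2w_1+\delta w_1w_2$ be a form in the homogeneous coordinates $P=(z_1:w_1,z_2:w_2)$ that satisfies, for some $A\in\mathbb C^*$, $f(a_1:b_1,t_1:t_2)=A\,f(t_1:t_2,a_2:b_2)$ for all $(t_1:t_2)$, and that does not vanish identically on the identified lines. Let $A_f$ be the ring of meromorphic functions on $\Gamma$ whose poles lie on the curve $f(P)=0$. (a) There are forms $f_1,f_2$ of the same kind (bidegree $(1,1)$) and constants $c_1,c_2\in\mathbb C$ such that $f_1,f_2,f$ are linearly independent and, with $F_i=f_i/f$, $F_i(p_1,t)-F_i(t,p_2)=c_i$ for $i=1,2$ and all $t$ at which both sides are defined. Fix any such $f_1,f_2,c_1,c_2$, any $\Lambda\in\mathbb C$ and any non-empty connected open set $U\subset\mathbb C^2$ (for instance a neighbourhood of $0$). Let $\mathcal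 O(U)$ be the ring of analytic functions of $(x,y)\in U$, and let $M(1)$ be the $\mathcal O(U)$-module of the functions $\psi(P,x,y)=\frac{h(P,x,y)}{f(P)}\exp(xF_1(P)+yF_2(P))$, where $h$ is a form of bidegree $(1,1)$ in $P$ with coefficients in $\mathcal O(U)$, that satisfy $\psi(p_1,t,x,y)=\Lambda\,\psi(t,p_2,x,y)$ for all $t$ at which both sides are defined. (b) There are $\psi_1,\psi_2\in M(1)$ such that, for every $(x,y)\in U$, $\psi_1(\cdot,x,y)$ and $\psi_2(\cdot,x,y)$ are linearly independent functions of $P$. (c) Let $\psi_1,\psi_2\in M(1)$ be linearly independent over $\mathcal O(U)$, and let $V$ be the set of all $(x,y)\in U$ such that $\Lambda e^{-c_1x-c_2y}\neq1$ and $\psi_1(\cdot,x,y),\psi_2(\cdot,x,y)$ are linearly independent functions of $P$. Then $V$ is open and dense in $U$. For every non-empty open $W\subset V$, let $\mathcal D(W)=\mathcal O(W)[\partial_x,\partial_y]$ be the ring of differential operators with coefficients analytic on $W$. Then there is an injective ring homomorphism $D:A_f\to \mathrm{Mat}(2,\mathcal D(W))$ such that, for every $\lambda\in A_f$, $D(\lambda)$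 is the unique element of $\mathrm{Mat}(2,\mathcal D(W))$ with $D(\lambda)\psi=\lambda\psi$ for the vector $\psi=(\psi_1,\psi_2)^{\top}$ (for all $(x,y)\in W$ and all $P$ with $f(P)\ne0$). In particular, the operators $D(\lambda)$ commute pairwise. -/

import Mathlib

open TopologicalSpace

noncomputable section

namespace BakerAkhiezer

/-- Homogeneous coordinates `(z : w)` on the complex projective line. -/
abbrev Vec : Type := Fin 2 → ℂ

/-- The complex projective line. -/
abbrev PLine : Type := Projectivization ℂ Vec

/-- The form of bidegree `(1, 1)` with coefficient matrix `F = !![α, β; γ, δ]`; its value at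
`v = (z₁, w₁)`, `w = (z₂, w₂)` is `α z₁ z₂ + β z₁ w₂ + γ w₁ z₂ + δ w₁ w₂`. -/
def form (F : Matrix (Fin 2) (Fin 2) ℂ) (v w : Vec) : ℂ :=
  ∑ i, ∑ j, F i j * (v i * w j)

/-- The identification `(p₁, t) ∼ (t, p₂)` of two lines in the product of two projective lines. -/
inductive Glue (p₁ p₂ : PLine) : PLine × PLine → PLine × PLine → Prop
  | glue (t : PLine) : Glue p₁ p₂ (p₁, t) (t, p₂)

/-- The surface `Γ`: the quotient of the product of two projective lines by the equivalence
relation generated by `(p₁, t) ∼ (t, p₂)`. -/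
def Gamma (p₁ p₂ : PLine) : Type := Quot (Glue p₁ p₂)

/-- The point of `Γ` with homogeneous coordinates `(v, w)`. -/
def pt (p₁ p₂ : PLine) (v w : Vec) (hv : v ≠ 0) (hw : w ≠ 0) : Gamma p₁ p₂ :=
  Quot.mk _ (Projectivization.mk ℂ v hv, Projectivization.mk ℂ w hw)

/-- The curve `f(P) = 0` on `Γ`. -/
def curve (p₁ p₂ : PLine) (f : Matrix (Fin 2) (Fin 2) ℂ) : Set (Gamma p₁ p₂) :=
  {P | ∃ (v w : Vec) (hv : v ≠ 0) (hw : w ≠ 0), form f v w = 0 ∧ P = pt p₁ p₂ v w hv hw}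

theorem analyticOnNhd_form_pow (f : Matrix (Fin 2) (Fin 2) ℂ) (n : ℕ) (s : Set (Vec × Vec)) :
    AnalyticOnNhd ℂ (fun q : Vec × Vec => form f q.1 q.2 ^ n) s := by
  intro q _
  have h1 : ∀ i : Fin 2, AnalyticAt ℂ (fun q : Vec × Vec => q.1 i) q := fun i =>
    ((ContinuousLinearMap.proj (R := ℂ) (φ := fun _ : Fin 2 => ℂ) i).comp
      (ContinuousLinearMap.fst ℂ Vec Vec)).analyticAt q
  have h2 : ∀ i : Fin 2, AnalyticAt ℂ (fun q : Vec × Vec => q.2 i) q := fun i =>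
    ((ContinuousLinearMap.proj (R := ℂ) (φ := fun _ : Fin 2 => ℂ) i).comp
      (ContinuousLinearMap.snd ℂ Vec Vec)).analyticAt q
  simp only [form, Fin.sum_univ_two]
  exact ((((analyticAt_const.mul ((h1 0).mul (h2 0))).add
    (analyticAt_const.mul ((h1 0).mul (h2 1)))).add
    ((analyticAt_const.mul ((h1 1).mul (h2 0))).add
    (analyticAt_const.mul ((h1 1).mul (h2 1)))))).pow n

/-- The ring `A_f` of meromorphic functions on `Γ` with poles on the curve `f(P) = 0`: functions
`lam` on the complement of the curve in `Γ` whose pull-back to the product of two projective lines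
has, for some `n`, a pole of order at most `n` along the curve, that is, `lam * f ^ n` extends to
a holomorphic function of the homogeneous coordinates. (Off the curve, `lam` is then holomorphic.)
-/
def meroRing (p₁ p₂ : PLine) (f : Matrix (Fin 2) (Fin 2) ℂ) :
    Subalgebra ℂ ({P : Gamma p₁ p₂ // P ∉ curve p₁ p₂ f} → ℂ) where
  carrier := {lam | ∃ (n : ℕ) (G : Vec × Vec → ℂ),
    AnalyticOnNhd ℂ G {q | q.1 ≠ 0 ∧ q.2 ≠ 0} ∧
    ∀ (v w : Vec) (hv : v ≠ 0) (hw : w ≠ 0) (hP : pt p₁ p₂ v w hv hw ∉ curve p₁ p₂ f),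
      lam ⟨pt p₁ p₂ v w hv hw, hP⟩ * form f v w ^ n = G (v, w)}
  mul_mem' := by
    rintro a b ⟨n, G, hG, ha⟩ ⟨m, H, hH, hb⟩
    refine ⟨n + m, G * H, hG.mul hH, fun v w hv hw hP => ?_⟩
    rw [Pi.mul_apply, Pi.mul_apply, ← ha v w hv hw hP, ← hb v w hv hw hP]
    ring
  add_mem' := by
    rintro a b ⟨n, G, hG, ha⟩ ⟨m, H, hH, hb⟩
    refine ⟨n + m, fun q => G q * form f q.1 q.2 ^ m + H q * form f q.1 q.2 ^ n,
      (hG.mul (analyticOnNhd_form_pow f m _)).add (hH.mul (analyticOnNhd_form_pow f n _)),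
      fun v w hv hw hP => ?_⟩
    simp only [Pi.add_apply]
    rw [← ha v w hv hw hP, ← hb v w hv hw hP]
    ring
  algebraMap_mem' := fun c => ⟨0, fun _ => c, analyticOnNhd_const, fun v w hv hw hP => by
    simp [Pi.algebraMap_apply]⟩

/-- Extension by zero of a function on an open subset of `ℂ²`. -/
def ext0 {U : Opens (ℂ × ℂ)} (g : U → ℂ) : ℂ × ℂ → ℂ :=
  Function.extend Subtype.val g 0

theorem ext0_apply {U : Opens (ℂ × ℂ)} (g : U → ℂ) (q : U) : ext0 g q = g q :=
  Subtype.val_injective.extend_apply g 0 q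

theorem ext0_eventuallyEq {U : Opens (ℂ × ℂ)} (g : U → ℂ) (G : ℂ × ℂ → ℂ)
    (h : ∀ q : U, g q = G q) (q : U) : ext0 g =ᶠ[nhds (q : ℂ × ℂ)] G := by
  filter_upwards [U.isOpen.mem_nhds q.2] with r hr
  exact (ext0_apply g ⟨r, hr⟩).trans (h ⟨r, hr⟩)

/-- The ring `𝒪(U)` of analytic functions of `(x, y)` on the open set `U` in `ℂ²`. -/
def holo (U : Opens (ℂ × ℂ)) : Subalgebra ℂ (U → ℂ) where
  carrier := {g | ∀ q : U, AnalyticAt ℂ (ext0 g) q}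
  mul_mem' := fun {a b} ha hb q => ((ha q).mul (hb q)).congr
    (ext0_eventuallyEq _ _ (fun r => by
      rw [Pi.mul_apply, Pi.mul_apply, ext0_apply, ext0_apply]) q).symm
  add_mem' := fun {a b} ha hb q => ((ha q).add (hb q)).congr
    (ext0_eventuallyEq _ _ (fun r => by
      rw [Pi.add_apply, Pi.add_apply, ext0_apply, ext0_apply]) q).symm
  algebraMap_mem' := fun c q => (analyticAt_const (v := c)).congr
    (ext0_eventuallyEq _ _ (fun _ => rfl) q).symm

/-- An everywhere analytic function, restricted to `U`. -/
def holo.mk' (U : Opens (ℂ × ℂ)) (G : ℂ × ℂ → ℂ) (hG : ∀ q ∈ U, AnalyticAt ℂ G q) : holo U :=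
  ⟨fun q => G q, fun q => (hG q q.2).congr (ext0_eventuallyEq _ _ (fun _ => rfl) q).symm⟩

/-- Restriction of analytic functions to a smaller open set. -/
def holo.res {W U : Opens (ℂ × ℂ)} (h : W ≤ U) (g : holo U) : holo W :=
  holo.mk' W (ext0 g.1) fun q hq => g.2 ⟨q, h hq⟩

/-- The derivative of analytic functions on `U` in the constant direction `e`. -/
def pderiv (U : Opens (ℂ × ℂ)) (e : ℂ × ℂ) : Module.End ℂ (holo U) where
  toFun g := holo.mk' U (fun q => fderiv ℂ (ext0 g.1) q e) fun q hq =>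
    ((ContinuousLinearMap.apply ℂ ℂ e).analyticAt _).comp (g.2 ⟨q, hq⟩).fderiv
  map_add' a b := Subtype.ext <| funext fun q => by
    have h : ext0 (a + b).1 =ᶠ[nhds (q : ℂ × ℂ)] (ext0 a.1 + ext0 b.1) :=
      ext0_eventuallyEq _ _ (fun r => by
        rw [Pi.add_apply, ext0_apply, ext0_apply]; rfl) q
    change fderiv ℂ (ext0 (a + b).1) q e = fderiv ℂ (ext0 a.1) q e + fderiv ℂ (ext0 b.1) q e
    rw [h.fderiv_eq, fderiv_add (a.2 q).differentiableAt (b.2 q).differentiableAt]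
    rfl
  map_smul' c a := Subtype.ext <| funext fun q => by
    have h : ext0 (c • a).1 =ᶠ[nhds (q : ℂ × ℂ)] (c • ext0 a.1) :=
      ext0_eventuallyEq _ _ (fun r => by
        rw [Pi.smul_apply, ext0_apply]; rfl) q
    change fderiv ℂ (ext0 (c • a).1) q e = c • fderiv ℂ (ext0 a.1) q e
    rw [h.fderiv_eq, fderiv_const_smul (a.2 q).differentiableAt]
    rfl

/-- The ring `𝒟(U) = 𝒪(U)[∂ₓ, ∂_y]` of linear differential operators on `U` with analytic
coefficients: the algebra of operators on `𝒪(U)` generated by the multiplications by elements of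
`𝒪(U)` and by the two partial derivatives. -/
def diffOp (U : Opens (ℂ × ℂ)) : Subalgebra ℂ (Module.End ℂ (holo U)) :=
  Algebra.adjoin ℂ
    (Set.range (fun g : holo U => LinearMap.mulLeft ℂ g) ∪ {pderiv U (1, 0), pderiv U (0, 1)})

/-- The action of a `2 × 2` matrix differential operator on a column of two functions. -/
def act {U : Opens (ℂ × ℂ)} (B : Matrix (Fin 2) (Fin 2) (diffOp U)) (g : Fin 2 → holo U) :
    Fin 2 → holo U :=
  fun i => ∑ j, (B i j : Module.End ℂ (holo U)) (g j)

/-- The exponential factor `exp (x F₁(P) + y F₂(P))` with `Fᵢ = fᵢ / f`, as a function of `(x, y)`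
on `U`, at the point `P` with homogeneous coordinates `(v, w)`. -/
def expFactor (U : Opens (ℂ × ℂ)) (f f₁ f₂ : Matrix (Fin 2) (Fin 2) ℂ) (v w : Vec) : holo U :=
  holo.mk' U
    (fun q => Complex.exp (q.1 * (form f₁ v w / form f v w) + q.2 * (form f₂ v w / form f v w)))
    fun _ _ => ((analyticAt_fst.mul analyticAt_const).add
      (analyticAt_snd.mul analyticAt_const)).cexp

/-- The function `ψ(P, x, y) = h(P, x, y) / f(P) * exp (x F₁(P) + y F₂(P))`, where `h` is a form of
bidegree `(1, 1)` in `P` with coefficients in `𝒪(U)`. The point `P` is given by homogeneous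
coordinates `(v, w)` with `f(v, w) ≠ 0`, and `ψ(P, ·)` is an element of `𝒪(U)`. -/
def psi {U : Opens (ℂ × ℂ)} (f f₁ f₂ : Matrix (Fin 2) (Fin 2) ℂ)
    (h : Matrix (Fin 2) (Fin 2) (holo U)) (v w : Vec) : holo U :=
  (∑ i, ∑ j, (v i * w j / form f v w) • h i j) * expFactor U f f₁ f₂ v w

/-- The gluing condition `g(p₁, t) / f(p₁, t) - g(t, p₂) / f(t, p₂) = c` for all `t`. -/
def IsPotential (p₁ p₂ : Vec) (f g : Matrix (Fin 2) (Fin 2) ℂ) (c : ℂ) : Prop :=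
  ∀ t : Vec, form f p₁ t ≠ 0 → form g p₁ t / form f p₁ t - form g t p₂ / form f t p₂ = c

/-- The function `ψ` with numerator `h` lies in the module `M(1)` over `U`: it satisfies
`ψ(p₁, t, x, y) = Λ ψ(t, p₂, x, y)` for all `t`. -/
def IsBAFunction {U : Opens (ℂ × ℂ)} (p₁ p₂ : Vec) (f f₁ f₂ : Matrix (Fin 2) (Fin 2) ℂ) (Lam : ℂ)
    (h : Matrix (Fin 2) (Fin 2) (holo U)) : Prop :=
  ∀ t : Vec, form f p₁ t ≠ 0 → psi f f₁ f₂ h p₁ t = Lam • psi f f₁ f₂ h t p₂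

/-- The functions `ψ₁(·, x, y)` and `ψ₂(·, x, y)` of the point `P` are linearly independent over
`ℂ` at the given `q = (x, y)`. -/
def IndepAt {U : Opens (ℂ × ℂ)} (f f₁ f₂ : Matrix (Fin 2) (Fin 2) ℂ)
    (h : Fin 2 → Matrix (Fin 2) (Fin 2) (holo U)) (q : U) : Prop :=
  LinearIndependent ℂ (fun (k : Fin 2) (v w : Vec) => (psi f f₁ f₂ (h k) v w).1 q)

/-- The regular locus in `U`: the points `q = (x, y)` with `Λ exp (-(c₁ x + c₂ y)) ≠ 1` at which
`ψ₁` and `ψ₂` are linearly independent functions of `P`. -/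
def regularLocus {U : Opens (ℂ × ℂ)} (f f₁ f₂ : Matrix (Fin 2) (Fin 2) ℂ) (c₁ c₂ Lam : ℂ)
    (h : Fin 2 → Matrix (Fin 2) (Fin 2) (holo U)) : Set U :=
  {q | Lam * Complex.exp (-(c₁ * q.1.1 + c₂ * q.1.2)) ≠ 1 ∧ IndepAt f f₁ f₂ h q}

/-- The equation `B ψ = lam ψ` over `W`, at all points `P` of the product of two projective lines
off the curve `f(P) = 0`; `ψ = (ψ₁, ψ₂)` has the numerators `h 0` and `h 1`. -/
def IsEigen {W : Opens (ℂ × ℂ)} (p₁ p₂ : PLine) (f f₁ f₂ : Matrix (Fin 2) (Fin 2) ℂ)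
    (h : Fin 2 → Matrix (Fin 2) (Fin 2) (holo W)) (lam : meroRing p₁ p₂ f)
    (B : Matrix (Fin 2) (Fin 2) (diffOp W)) : Prop :=
  ∀ (v w : Vec) (hv : v ≠ 0) (hw : w ≠ 0) (hP : pt p₁ p₂ v w hv hw ∉ curve p₁ p₂ f),
    act B (fun k => psi f f₁ f₂ (h k) v w) =
      lam.1 ⟨pt p₁ p₂ v w hv hw, hP⟩ • fun k => psi f f₁ f₂ (h k) v w

end BakerAkhiezer

end

open BakerAkhiezer

/-! Write `p₁ = A • q` and `p = p₂`, so that `f(q, t) = f(t, p)`. In the basis `q, p` the form `f`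
is determined, up to a factor, by one modulus `κ = f(p, q) / f(p, p)`. With `v = a q + b p`, `w = a'
q + b' p` and `f` scaled to one, the complement of `f = 0` is the affine surface with coordinates `u
= b a'`, `m = 2 a a' + a b'`, `r = a a'`, on which `r` is quadratic over `ℂ[u, m]`. The two glued
lines are `(u, m, r) = (0, τ + 1, τ)` and `(0, τ, 0)`. Every potential is `F = β + c m + γ u`;
independence of `f₁, f₂, f` says exactly that `c₁ γ₂ - c₂ γ₁ ≠ 0`, so suitable first-order operators
`opM`, `opU` multiply the exponential by `m` and by `u`.

Put `μ = Λ exp (-(c₁ x + c₂ y))`. The gluing condition forces `h(q, q) = μ h(q, p) = μ² h(p, p)`,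
hence `M(1)` is free of rank two on `η e` and `u e`, where `e` is the exponential and `η = (μ - 1)²
r + (μ - 1) m + 1 - κ u`. Off `μ = 1` and off the zeros of the determinant of coordinates, `ψ`
generates the same `𝒟`-module as this basis.

Existence of `D(λ)`: elements of `A_f` are regular functions `n` on the surface
(`Frame.exists_regFun`, a Liouville argument), and `n ψ` must lie in the `𝒟`-module `T` generated by
`ψ`. All of `u n e` lies in `T` (`cU_mul_mem`). Modulo these, `n η` is `a(m) + r b(m)`, and gluing
gives `a(1) = μ a(0)` and determines `b` from `a`. Since `opM` has eigenvalue `m - k` on `μᵏ e`,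
polynomials in `opM` applied to `η e` produce the parts `a = μ m p(m - 1) - (m - 1) p(m)`, and these
exhaust the admissible `a` (`exists_shift_eq`, `mul_eta_mem`).

Uniqueness: an operator that kills `e` for generic `(u, m)` has zero symbol, hence is zero. Over a
generic `(u, m)` there are two values of `r`; subtracting the two equations separates `η e` from `u
e` (`eq_zero_of_apply_eta_add`). The ring homomorphism laws and commutativity follow from
uniqueness. -/

noncomputable section

namespace BakerAkhiezer

/-! ### Analytic functions on open subsets of `ℂ²` -/

section Holo

variable {U : Opens (ℂ × ℂ)}

/-- Evaluation of analytic functions at a point. -/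
def holo.ev (q : U) : holo U →ₐ[ℂ] ℂ := (Pi.evalAlgHom ℂ (fun _ : U => ℂ) q).comp (holo U).val

theorem holo.ev_apply (q : U) (g : holo U) : holo.ev q g = g.1 q := rfl

theorem holo.ext_ev {a b : holo U} (h : ∀ q : U, holo.ev q a = holo.ev q b) : a = b :=
  Subtype.ext (funext h)

theorem holo.ev_mk' (G : ℂ × ℂ → ℂ) (hG : ∀ q ∈ U, AnalyticAt ℂ G q) (q : U) :
    holo.ev q (holo.mk' U G hG) = G q := rfl

theorem ext0_mk' (G : ℂ × ℂ → ℂ) (hG : ∀ q ∈ U, AnalyticAt ℂ G q) (q : U) :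
    ext0 (holo.mk' U G hG).1 =ᶠ[nhds (q : ℂ × ℂ)] G :=
  ext0_eventuallyEq _ _ (fun _ => rfl) q

theorem ev_pderiv (e : ℂ × ℂ) (g : holo U) (q : U) :
    holo.ev q (pderiv U e g) = fderiv ℂ (ext0 g.1) q e := rfl

theorem pderiv_mul (e : ℂ × ℂ) (a b : holo U) :
    pderiv U e (a * b) = pderiv U e a * b + a * pderiv U e b := by
  refine holo.ext_ev fun q => ?_
  have h : ext0 (a * b).1 =ᶠ[nhds (q : ℂ × ℂ)] (ext0 a.1 * ext0 b.1) :=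
    ext0_eventuallyEq _ _ (fun r => by rw [Pi.mul_apply, ext0_apply, ext0_apply]; rfl) q
  rw [map_add, map_mul (holo.ev q), map_mul (holo.ev q), ev_pderiv, ev_pderiv, ev_pderiv,
    h.fderiv_eq, fderiv_mul (a.2 q).differentiableAt (b.2 q).differentiableAt, holo.ev_apply,
    holo.ev_apply, ext0_apply, ext0_apply]
  simp only [add_apply, smul_apply, smul_eq_mul]
  ring

theorem pderiv_eq (e : ℂ × ℂ) : pderiv U e = e.1 • pderiv U (1, 0) + e.2 • pderiv U (0, 1) := by
  refine LinearMap.ext fun g => holo.ext_ev fun q => ?_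
  simp only [LinearMap.add_apply, LinearMap.smul_apply, map_add, map_smul, ev_pderiv]
  rw [← map_smul, ← map_smul, ← map_add]
  simp

theorem pderiv_comm (e e' : ℂ × ℂ) : pderiv U e * pderiv U e' = pderiv U e' * pderiv U e := by
  refine LinearMap.ext fun g => holo.ext_ev fun q => ?_
  have key : ∀ e e' : ℂ × ℂ, holo.ev q ((pderiv U e * pderiv U e') g) =
      fderiv ℂ (fderiv ℂ (ext0 g.1)) q e e' := by
    intro e e'
    have h := ext0_mk' (U := U) (fun q => fderiv ℂ (ext0 g.1) q e') (fun q hq =>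
      ((ContinuousLinearMap.apply ℂ ℂ e').analyticAt _).comp (g.2 ⟨q, hq⟩).fderiv) q
    change fderiv ℂ (ext0 (pderiv U e' g).1) q e = _
    refine (congrArg (fun L : ℂ × ℂ →L[ℂ] ℂ => L e) h.fderiv_eq).trans ?_
    rw [fderiv_clm_apply (g.2 q).fderiv.differentiableAt (differentiableAt_const _)]
    simp
  rw [key, key]
  exact (g.2 q).contDiffAt.isSymmSndFDerivAt (n := ⊤) (by simp) e e'

/-- The exponential `exp (x X.1 + y X.2)`. -/
def expo (U : Opens (ℂ × ℂ)) (X : ℂ × ℂ) : holo U :=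
  holo.mk' U (fun q => Complex.exp (q.1 * X.1 + q.2 * X.2))
    fun _ _ => ((analyticAt_fst.mul analyticAt_const).add
      (analyticAt_snd.mul analyticAt_const)).cexp

theorem ev_expo (X : ℂ × ℂ) (q : U) :
    holo.ev q (expo U X) = Complex.exp (q.1.1 * X.1 + q.1.2 * X.2) := rfl

theorem expo_add (X Y : ℂ × ℂ) : expo U (X + Y) = expo U X * expo U Y := by
  refine holo.ext_ev fun q => ?_
  rw [map_mul, ev_expo, ev_expo, ev_expo, ← Complex.exp_add]
  congr 1
  simp only [Prod.fst_add, Prod.snd_add]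
  ring

theorem expo_zero : expo U 0 = 1 := by
  refine holo.ext_ev fun q => ?_
  simp [ev_expo]

theorem isUnit_expo (X : ℂ × ℂ) : IsUnit (expo U X) :=
  IsUnit.of_mul_eq_one (expo U (-X)) (by rw [← expo_add, add_neg_cancel, expo_zero])

theorem pderiv_expo (e X : ℂ × ℂ) :
    pderiv U e (expo U X) = (e.1 * X.1 + e.2 * X.2) • expo U X := by
  refine holo.ext_ev fun q => ?_
  rw [ev_pderiv, map_smul, ev_expo]
  refine (congrArg (fun L : ℂ × ℂ →L[ℂ] ℂ => L e) (ext0_mk' (U := U) _ _ q).fderiv_eq).trans ?_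
  have h : HasFDerivAt (fun q : ℂ × ℂ => Complex.exp (q.1 * X.1 + q.2 * X.2)) _ q.1 :=
    (((hasFDerivAt_fst (𝕜 := ℂ) (p := q.1)).mul_const X.1).add
      ((hasFDerivAt_snd (𝕜 := ℂ) (p := q.1)).mul_const X.2)).cexp
  rw [h.fderiv]
  simp
  ring

theorem isUnit_of_ev_ne_zero {g : holo U} (h : ∀ q : U, holo.ev q g ≠ 0) : IsUnit g := by
  refine IsUnit.of_mul_eq_one (holo.mk' U (fun q => (ext0 g.1 q)⁻¹) fun q hq =>
    (g.2 ⟨q, hq⟩).inv ?_) ?_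
  · rw [ext0_apply g.1 ⟨q, hq⟩]
    exact h _
  · refine holo.ext_ev fun q => ?_
    rw [map_mul, holo.ev_mk', ext0_apply]
    exact mul_inv_cancel₀ (h q)

theorem ev_res {W : Opens (ℂ × ℂ)} (h : W ≤ U) (g : holo U) (q : W) :
    holo.ev q (holo.res h g) = holo.ev ⟨q.1, h q.2⟩ g := ext0_apply g.1 ⟨q.1, h q.2⟩

theorem continuous_ev (g : holo U) : Continuous fun q : U => holo.ev q g := by
  refine continuous_iff_continuousAt.2 fun q => ?_
  have h : ContinuousAt (fun r : U => ext0 g.1 r) q :=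
    ContinuousAt.comp (g := ext0 g.1) (g.2 q).continuousAt continuous_subtype_val.continuousAt
  exact h.congr (Filter.Eventually.of_forall fun r => ext0_apply g.1 r)

/-- The identity theorem: the zero set of a nonzero analytic function is nowhere dense. -/
theorem dense_ev_ne_zero (hU : IsConnected (U : Set (ℂ × ℂ))) {g : holo U} (hg : g ≠ 0) :
    Dense {q : U | holo.ev q g ≠ 0} := by
  refine dense_iff_inter_open.2 fun O hO hne => ?_
  by_contra hemp
  obtain ⟨z, hz⟩ := hne
  have hev : ext0 g.1 =ᶠ[nhds (z : ℂ × ℂ)] 0 := by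
    have hO' : (Subtype.val '' O : Set (ℂ × ℂ)) ∈ nhds (z : ℂ × ℂ) :=
      (U.isOpen.isOpenMap_subtype_val O hO).mem_nhds ⟨z, hz, rfl⟩
    filter_upwards [hO']
    rintro _ ⟨q, hq, rfl⟩
    rw [ext0_apply]
    by_contra h0
    exact hemp ⟨q, hq, h0⟩
  have hz0 := AnalyticOnNhd.eqOn_zero_of_preconnected_of_eventuallyEq_zero
    (fun q hq => g.2 ⟨q, hq⟩) hU.isPreconnected z.2 hev
  exact hg (holo.ext_ev fun q => by
    rw [holo.ev_apply, ← ext0_apply g.1 q, hz0 q.2, map_zero]; rfl)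

/-- `U` need not be connected here, so `holo U` may have zero divisors; the root count is made over
`ℂ`, after evaluating the coefficients at each point. -/
theorem polynomial_eq_zero (p : Polynomial (holo U)) (S : Set ℂ) (hS : S.Infinite)
    (h : ∀ τ ∈ S, p.eval (algebraMap ℂ (holo U) τ) = 0) : p = 0 := by
  refine Polynomial.ext fun n => holo.ext_ev fun q => ?_
  have : p.map (holo.ev q).toRingHom = 0 := by
    refine Polynomial.eq_zero_of_infinite_isRoot _ (hS.mono fun τ hτ => ?_)
    have := congrArg (holo.ev q) (h τ hτ)
    change Polynomial.eval τ _ = 0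
    have hh := Polynomial.hom_eval₂ p (RingHom.id _) (holo.ev q).toRingHom (algebraMap ℂ (holo U) τ)
    rw [RingHom.comp_id] at hh
    rw [Polynomial.eval_map, ← Algebra.algebraMap_self_apply τ, ← (holo.ev q).commutes τ]
    refine hh.symm.trans ?_
    exact this.trans (map_zero _)
  simpa using congrArg (fun r => r.coeff n) this

end Holo

/-! ### Normal form and symbols of differential operators -/

section Operators

variable {U : Opens (ℂ × ℂ)}

theorem mulLeft_mem_diffOp (g : holo U) : LinearMap.mulLeft ℂ g ∈ diffOp U :=
  Algebra.subset_adjoin (Or.inl ⟨g, rfl⟩)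

theorem pderiv_mem_diffOp (e : ℂ × ℂ) : pderiv U e ∈ diffOp U := by
  rw [pderiv_eq]
  exact (diffOp U).add_mem ((diffOp U).smul_mem (Algebra.subset_adjoin (Or.inr (Or.inl rfl))) _)
    ((diffOp U).smul_mem (Algebra.subset_adjoin (Or.inr (Or.inr rfl))) _)

/-- The first-order operator `∂ₑ - b`. -/
def shiftDeriv (U : Opens (ℂ × ℂ)) (e : ℂ × ℂ) (b : ℂ) : Module.End ℂ (holo U) :=
  pderiv U e + (-b) • 1

theorem shiftDeriv_mem_diffOp (e : ℂ × ℂ) (b : ℂ) : shiftDeriv U e b ∈ diffOp U :=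
  (diffOp U).add_mem (pderiv_mem_diffOp e) ((diffOp U).smul_mem (one_mem _) _)

theorem shiftDeriv_comm (e e' : ℂ × ℂ) (b b' : ℂ) :
    Commute (shiftDeriv U e b) (shiftDeriv U e' b') := by
  refine Commute.add_left (Commute.add_right (pderiv_comm e e') ?_) ?_
  · exact (Commute.one_right _).smul_right _
  · exact (Commute.one_left _).smul_left _

theorem shiftDeriv_expo (e : ℂ × ℂ) (b : ℂ) (X : ℂ × ℂ) :
    shiftDeriv U e b (expo U X) = (e.1 * X.1 + e.2 * X.2 - b) • expo U X := by
  rw [shiftDeriv, LinearMap.add_apply, LinearMap.smul_apply, Module.End.one_apply, pderiv_expo,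
    ← add_smul, sub_eq_add_neg]

/-- The Leibniz rule as a commutation relation: it moves coefficients to the left of derivatives. -/
theorem shiftDeriv_mul_mulLeft (e : ℂ × ℂ) (b : ℂ) (g : holo U) :
    shiftDeriv U e b * LinearMap.mulLeft ℂ g =
      LinearMap.mulLeft ℂ (pderiv U e g) + LinearMap.mulLeft ℂ g * shiftDeriv U e b := by
  refine LinearMap.ext fun a => ?_
  simp only [shiftDeriv, Module.End.mul_apply, LinearMap.add_apply,
    LinearMap.smul_apply, Module.End.one_apply, LinearMap.mulLeft_apply, pderiv_mul, mul_add,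
    mul_smul_comm]
  abel

theorem mulLeft_mul (g : holo U) (F : Module.End ℂ (holo U)) : LinearMap.mulLeft ℂ g * F = g • F :=
  rfl

/-- The operator `∑ gₐ X ^ a₀ Y ^ a₁` with coefficients written on the left. -/
def opOf (X Y : Module.End ℂ (holo U)) :
    MvPolynomial (Fin 2) (holo U) →ₗ[holo U] Module.End ℂ (holo U) :=
  (MvPolynomial.basisMonomials (Fin 2) (holo U)).constr ℕ
    fun a : Fin 2 →₀ ℕ => (X ^ a 0 * Y ^ a 1 : Module.End ℂ (holo U))

theorem opOf_monomial (X Y : Module.End ℂ (holo U)) (a : Fin 2 →₀ ℕ) (g : holo U) :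
    opOf X Y (MvPolynomial.monomial a g) = LinearMap.mulLeft ℂ g * (X ^ a 0 * Y ^ a 1) := by
  have h : MvPolynomial.monomial a g = g • MvPolynomial.basisMonomials (Fin 2) (holo U) a := by
    rw [MvPolynomial.coe_basisMonomials, MvPolynomial.smul_monomial, smul_eq_mul, mul_one]
  rw [h, map_smul, opOf, Module.Basis.constr_basis, mulLeft_mul]

/-- Normal ordering: operators with coefficients on the left form a space that contains `1` and is
stable under left multiplication by every generator of `diffOp U`, because `e, e'` span all
directions. -/
theorem exists_opOf {e e' : ℂ × ℂ} (b b' : ℂ) (hspan : ∀ x : ℂ × ℂ, ∃ k l : ℂ, x = k • e + l • e')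
    {E : Module.End ℂ (holo U)} (hE : E ∈ diffOp U) :
    ∃ c, opOf (shiftDeriv U e b) (shiftDeriv U e' b') c = E := by
  set X := shiftDeriv U e b with hX
  set Y := shiftDeriv U e' b' with hY
  let S : Submodule (holo U) (Module.End ℂ (holo U)) := LinearMap.range (opOf X Y)
  have hmul : ∀ g : holo U, ∀ F ∈ S, LinearMap.mulLeft ℂ g * F ∈ S := by
    exact fun g F hF => S.smul_mem g hF
  have hsmul : ∀ z : ℂ, ∀ F ∈ S, z • F ∈ S := by
    intro z F hF
    have := hmul (algebraMap ℂ _ z) F hF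
    convert this using 1
    refine LinearMap.ext fun a => ?_
    simp [Algebra.smul_def]
  have hadd : ∀ F G, F ∈ S → G ∈ S → F + G ∈ S := fun F G => S.add_mem
  have hXS : ∀ F ∈ S, X * F ∈ S := by
    rintro _ ⟨c, rfl⟩
    induction c using MvPolynomial.induction_on' with
    | monomial a h =>
      rw [opOf_monomial, ← mul_assoc, hX, shiftDeriv_mul_mulLeft, ← hX, add_mul]
      refine hadd _ _ ⟨MvPolynomial.monomial a (pderiv U e h), opOf_monomial _ _ _ _⟩
        ⟨MvPolynomial.monomial (a + Finsupp.single 0 1) h, ?_⟩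
      rw [opOf_monomial, mul_assoc, ← mul_assoc X, ← pow_succ']
      simp
    | add p q hp hq =>
      rw [map_add, mul_add]
      exact hadd _ _ hp hq
  have hYS : ∀ F ∈ S, Y * F ∈ S := by
    rintro _ ⟨c, rfl⟩
    induction c using MvPolynomial.induction_on' with
    | monomial a h =>
      rw [opOf_monomial, ← mul_assoc, hY, shiftDeriv_mul_mulLeft, ← hY, add_mul]
      refine hadd _ _ ⟨MvPolynomial.monomial a (pderiv U e' h), opOf_monomial _ _ _ _⟩
        ⟨MvPolynomial.monomial (a + Finsupp.single 1 1) h, ?_⟩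
      rw [opOf_monomial, mul_assoc, ← mul_assoc Y,
        ((shiftDeriv_comm e' e b' b).pow_right _).eq, mul_assoc (X ^ _), ← pow_succ']
      simp [hY]
    | add p q hp hq =>
      rw [map_add, mul_add]
      exact hadd _ _ hp hq
  have hpd : ∀ x : ℂ × ℂ, ∀ F ∈ S, pderiv U x * F ∈ S := by
    intro x F hF
    obtain ⟨k, l, hx⟩ := hspan x
    have : pderiv U x = k • X + l • Y + (k * b + l * b') • 1 := by
      rw [hX, hY, shiftDeriv, shiftDeriv, pderiv_eq x, pderiv_eq e, pderiv_eq e', hx]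
      simp only [Prod.fst_add, Prod.smul_fst, Prod.snd_add, Prod.smul_snd, smul_eq_mul]
      module
    rw [this, add_mul, add_mul, smul_mul_assoc, smul_mul_assoc, smul_mul_assoc, one_mul]
    exact hadd _ _ (hadd _ _ (hsmul _ _ (hXS F hF)) (hsmul _ _ (hYS F hF))) (hsmul _ _ hF)
  have hall : ∀ F ∈ S, E * F ∈ S := by
    induction hE using Algebra.adjoin_induction with
    | mem x hx =>
      rcases hx with ⟨g, rfl⟩ | rfl | rfl
      · exact hmul g
      · exact hpd _
      · exact hpd _
    | algebraMap r =>
      intro F hF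
      rw [← Algebra.smul_def]
      exact hsmul r F hF
    | add x y _ _ hx hy =>
      intro F hF
      rw [add_mul]
      exact hadd _ _ (hx F hF) (hy F hF)
    | mul x y _ _ hx hy =>
      intro F hF
      rw [mul_assoc]
      exact hx _ (hy F hF)
  have h1 : (1 : Module.End ℂ (holo U)) ∈ S := by
    refine ⟨MvPolynomial.monomial 0 1, ?_⟩
    rw [opOf_monomial, LinearMap.mulLeft_one, ← Module.End.one_eq_id]
    simp
  obtain ⟨c, hc⟩ := hall 1 h1
  exact ⟨c, by rw [hc, mul_one]⟩

theorem pow_apply_of_eigen {X : Module.End ℂ (holo U)} {z : ℂ} {g : holo U} (h : X g = z • g)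
    (n : ℕ) : (X ^ n) g = z ^ n • g := by
  induction n with
  | zero => simp
  | succ n ih => rw [pow_succ', Module.End.mul_apply, ih, map_smul, h, smul_smul, pow_succ]

/-- On a joint eigenfunction a normally ordered operator acts through its full symbol, evaluated at
the pair of eigenvalues. -/
theorem ev_opOf_apply {X Y : Module.End ℂ (holo U)} {y z : ℂ} {g : holo U} (hX : X g = y • g)
    (hY : Y g = z • g) (c : MvPolynomial (Fin 2) (holo U)) (q : U) :
    holo.ev q (opOf X Y c g) =
      MvPolynomial.eval ![y, z] (c.map (holo.ev q).toRingHom) * holo.ev q g := by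
  induction c using MvPolynomial.induction_on' with
  | monomial a h =>
    rw [opOf_monomial, Module.End.mul_apply, Module.End.mul_apply, pow_apply_of_eigen hY, map_smul,
      pow_apply_of_eigen hX, LinearMap.mulLeft_apply, MvPolynomial.map_monomial,
      MvPolynomial.eval_monomial, Finsupp.prod_fintype _ _ (by simp), Fin.prod_univ_two]
    simp only [map_mul, map_smul, smul_eq_mul, Matrix.cons_val_zero, Matrix.cons_val_one]
    change holo.ev q h * _ = holo.ev q h * _ * _
    ring
  | add p q hp hq =>
    rw [map_add, LinearMap.add_apply, map_add, hp, hq, map_add, map_add, add_mul]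

/-- A differential operator that annihilates generic members of a family of joint eigenfunctions
is zero. -/
theorem eq_zero_of_apply_eigen {e e' : ℂ × ℂ} (b b' : ℂ)
    (hspan : ∀ x : ℂ × ℂ, ∃ k l : ℂ, x = k • e + l • e') {E : Module.End ℂ (holo U)}
    (hE : E ∈ diffOp U) (g : ℂ → ℂ → holo U)
    (hg : ∀ y z (q : U), holo.ev q (g y z) ≠ 0)
    (hX : ∀ y z, shiftDeriv U e b (g y z) = y • g y z)
    (hY : ∀ y z, shiftDeriv U e' b' (g y z) = z • g y z)
    (Z : MvPolynomial (Fin 2) ℂ) (hZ : Z ≠ 0)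
    (h : ∀ y z, MvPolynomial.eval ![y, z] Z ≠ 0 → E (g y z) = 0) : E = 0 := by
  obtain ⟨c, rfl⟩ := exists_opOf b b' hspan hE
  suffices hc : c = 0 by rw [hc, map_zero]
  refine MvPolynomial.ext _ _ fun a => holo.ext_ev fun q => ?_
  have hmap : c.map (holo.ev q).toRingHom = 0 := by
    -- The symbol is known to vanish only off the zeros of `Z`; multiplied by `Z` it vanishes
    -- everywhere, and polynomials over `ℂ` form a domain.
    refine (mul_eq_zero.1 (?_ : c.map (holo.ev q).toRingHom * Z = 0)).resolve_right hZ
    refine MvPolynomial.funext fun x => ?_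
    rw [map_mul, map_zero]
    by_cases hx : MvPolynomial.eval x Z = 0
    · rw [hx, mul_zero]
    · have hxx : x = ![x 0, x 1] := by ext i; fin_cases i <;> rfl
      have h1 := ev_opOf_apply (hX (x 0) (x 1)) (hY (x 0) (x 1)) c q
      rw [h _ _ (hxx ▸ hx), map_zero, ← hxx] at h1
      rw [(mul_eq_zero.1 h1.symm).resolve_right (hg _ _ q), zero_mul]
  have := congrArg (fun p => MvPolynomial.coeff a p) hmap
  simpa [MvPolynomial.coeff_map] using this

end Operators

/-! ### A difference equation for polynomials -/

section Algebra

open Polynomial in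
/-- The map `p ↦ μ X p(X - 1) - (X - 1) p(X)` is onto the polynomials `a` with `a(1) = μ a(0)`. -/
theorem exists_shift_eq {R : Type*} [CommRing R] (μ : R) (hμ : IsUnit (μ - 1)) (a : R[X])
    (ha : a.eval 1 = μ * a.eval 0) :
    ∃ p : R[X], a = C μ * X * p.comp (X - 1) - (X - 1) * p := by
  obtain ⟨ν, hν⟩ := hμ.exists_left_inv
  suffices h : ∀ (n : ℕ) (a : R[X]), a.natDegree ≤ n → a.eval 1 = μ * a.eval 0 →
      ∃ p : R[X], a = C μ * X * p.comp (X - 1) - (X - 1) * p from h _ a le_rfl ha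
  intro n
  induction n with
  | zero =>
    intro a hd ha
    obtain ⟨z, rfl⟩ : ∃ z, a = C z := ⟨_, eq_C_of_natDegree_le_zero hd⟩
    refine ⟨0, ?_⟩
    rw [eval_C, eval_C] at ha
    have : z = 0 := by linear_combination (-z) * hν - ν * ha
    simp [this]
  | succ n ih =>
    intro a hd ha
    -- The image of `z X ^ n` has top coefficient `(μ - 1) z` in degree `n + 1`; this `z` makes it
    -- cancel that of `a`. The condition at `0` and `1` is linear and holds for images, so the
    -- difference inherits it.
    obtain ⟨z, hz⟩ : ∃ z, z = ν * a.coeff (n + 1) := ⟨_, rfl⟩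
    set L := C μ * X * (C z * (X - 1) ^ n) - (X - 1) * (C z * X ^ n) with hL
    have hLform : L = C (μ * z) * ((X - 1) ^ n * X) - C z * (X ^ n * X) + C z * X ^ n := by
      rw [hL, C_mul]
      ring
    have hLd : L.natDegree ≤ n + 1 := by
      rw [hLform]
      compute_degree
    have hc1 : ((X - 1 : R[X]) ^ n).coeff n = 1 := by
      have h := coeff_pow_of_natDegree_le (p := (X - 1 : R[X])) (n := 1) (m := n)
        (by compute_degree)
      rw [mul_one] at h
      rw [h]
      simp [coeff_one]
    have hLc : L.coeff (n + 1) = a.coeff (n + 1) := by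
      rw [hLform]
      simp only [coeff_add, coeff_sub, coeff_C_mul, coeff_mul_X, hc1, coeff_X_pow]
      simp [hz]
      linear_combination (a.coeff (n + 1)) * hν
    obtain ⟨p, hp⟩ := ih (a - L) (by
      refine natDegree_le_iff_coeff_eq_zero.2 fun k hk => ?_
      rw [coeff_sub]
      rcases eq_or_lt_of_le (Nat.succ_le_of_lt hk) with rfl | hk
      · rw [Nat.succ_eq_add_one, hLc, sub_self]
      · rw [coeff_eq_zero_of_natDegree_lt (hd.trans_lt hk),
          coeff_eq_zero_of_natDegree_lt (hLd.trans_lt hk), sub_self]) (by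
      rw [eval_sub, eval_sub, ha, hL]
      simp
      ring)
    refine ⟨p + C z * X ^ n, ?_⟩
    rw [← sub_add_cancel a L, hp, hL]
    simp
    ring

end Algebra

/-! ### Exponentials and the operators with eigenvalues `m` and `u` -/

section Wave

variable {W : Opens (ℂ × ℂ)}

theorem expo_nsmul (X : ℂ × ℂ) (k : ℕ) : expo W X ^ k = expo W ((k : ℂ) • X) := by
  induction k with
  | zero => simp [expo_zero]
  | succ k ih => rw [pow_succ, ih, ← expo_add, Nat.cast_succ, add_smul, one_smul]

/-- The exponential with spectral parameters `u` and `m`. -/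
def wave (W : Opens (ℂ × ℂ)) (β c γ : ℂ × ℂ) (u m : ℂ) : holo W := expo W (β + m • c + u • γ)

/-- The multiplier `Λ exp (-(c₁ x + c₂ y))`. -/
def mult (W : Opens (ℂ × ℂ)) (c : ℂ × ℂ) (Lam : ℂ) : holo W := Lam • expo W (-c)

/-- The first-order operator that multiplies `wave W β c γ u m` by `m`. -/
def opM (W : Opens (ℂ × ℂ)) (β c γ : ℂ × ℂ) : Module.End ℂ (holo W) :=
  shiftDeriv W (γ.2 / (c.1 * γ.2 - c.2 * γ.1), -γ.1 / (c.1 * γ.2 - c.2 * γ.1))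
    (γ.2 / (c.1 * γ.2 - c.2 * γ.1) * β.1 + -γ.1 / (c.1 * γ.2 - c.2 * γ.1) * β.2)

/-- The first-order operator that multiplies `wave W β c γ u m` by `u`. -/
def opU (W : Opens (ℂ × ℂ)) (β c γ : ℂ × ℂ) : Module.End ℂ (holo W) :=
  shiftDeriv W (-c.2 / (c.1 * γ.2 - c.2 * γ.1), c.1 / (c.1 * γ.2 - c.2 * γ.1))
    (-c.2 / (c.1 * γ.2 - c.2 * γ.1) * β.1 + c.1 / (c.1 * γ.2 - c.2 * γ.1) * β.2)

variable {β c γ : ℂ × ℂ}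

theorem mult_pow_mul_wave (Lam u m : ℂ) (k : ℕ) :
    mult W c Lam ^ k * wave W β c γ u m =
      Lam ^ k • expo W ((k : ℂ) • (-c) + (β + m • c + u • γ)) := by
  rw [mult, wave, smul_pow, expo_nsmul, smul_mul_assoc, expo_add _ (β + m • c + u • γ)]

/-- By Cramer's rule the direction of `opM` pairs to `1` with `c` and to `0` with `γ`, and its
constant removes `β`. As `mult ^ k` is a multiple of `exp (-k c)`, it lowers the eigenvalue by `k`;
this shift produces the difference equation of `exists_shift_eq`. -/
theorem opM_mult_pow_mul_wave (h : c.1 * γ.2 - c.2 * γ.1 ≠ 0) (Lam u m : ℂ) (k : ℕ) :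
    opM W β c γ (mult W c Lam ^ k * wave W β c γ u m) =
      (m - k) • (mult W c Lam ^ k * wave W β c γ u m) := by
  rw [mult_pow_mul_wave, map_smul, opM, shiftDeriv_expo, smul_comm _ (Lam ^ k)]
  refine congrArg (fun y => Lam ^ k • y) (congrArg (fun y : ℂ => y • expo W _) ?_)
  simp only [Prod.fst_add, Prod.snd_add, Prod.smul_fst, Prod.smul_snd, Prod.fst_neg, Prod.snd_neg,
    smul_eq_mul]
  obtain ⟨d, hd⟩ : ∃ d, d = c.1 * γ.2 - c.2 * γ.1 := ⟨_, rfl⟩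
  rw [← hd] at h ⊢
  field_simp
  rw [hd]
  ring

/-- The direction of `opU` pairs to `0` with `c`, so powers of `mult` leave the eigenvalue `u`
unchanged. -/
theorem opU_mult_pow_mul_wave (h : c.1 * γ.2 - c.2 * γ.1 ≠ 0) (Lam u m : ℂ) (k : ℕ) :
    opU W β c γ (mult W c Lam ^ k * wave W β c γ u m) =
      u • (mult W c Lam ^ k * wave W β c γ u m) := by
  rw [mult_pow_mul_wave, map_smul, opU, shiftDeriv_expo, smul_comm _ (Lam ^ k)]
  refine congrArg (fun y => Lam ^ k • y) (congrArg (fun y : ℂ => y • expo W _) ?_)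
  simp only [Prod.fst_add, Prod.snd_add, Prod.smul_fst, Prod.smul_snd, Prod.fst_neg, Prod.snd_neg,
    smul_eq_mul]
  field_simp
  ring

theorem opM_wave (h : c.1 * γ.2 - c.2 * γ.1 ≠ 0) (u m : ℂ) :
    opM W β c γ (wave W β c γ u m) = m • wave W β c γ u m := by
  simpa using opM_mult_pow_mul_wave (W := W) (β := β) h 0 u m 0

theorem opU_wave (h : c.1 * γ.2 - c.2 * γ.1 ≠ 0) (u m : ℂ) :
    opU W β c γ (wave W β c γ u m) = u • wave W β c γ u m := by
  simpa using opU_mult_pow_mul_wave (W := W) (β := β) h 0 u m 0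

theorem opM_mem_diffOp : opM W β c γ ∈ diffOp W := shiftDeriv_mem_diffOp _ _

theorem opU_mem_diffOp : opU W β c γ ∈ diffOp W := shiftDeriv_mem_diffOp _ _

end Wave

/-! ### The affine surface and its regular functions -/

section Surface

/-- The affine surface `r² = r (m + (κ - 2) u - 1) + u m` in the coordinates `(u, m, r)`: the
complement of the curve `f = 0` in the product of two projective lines. -/
def Surf (κ : ℂ) : Type :=
  {x : ℂ × ℂ × ℂ // x.2.2 ^ 2 = x.2.2 * (x.2.1 + (κ - 2) * x.1 - 1) + x.1 * x.2.1}

variable {κ : ℂ}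

/-- The coordinate `u`. -/
def cU (x : Surf κ) : ℂ := x.1.1

/-- The coordinate `m`. -/
def cM (x : Surf κ) : ℂ := x.1.2.1

/-- The coordinate `r`. -/
def cR (x : Surf κ) : ℂ := x.1.2.2

/-- The point with coordinates `(u, m, r)`. -/
def Surf.of (u m r : ℂ) (h : r ^ 2 = r * (m + (κ - 2) * u - 1) + u * m) : Surf κ := ⟨(u, m, r), h⟩

@[simp]
theorem cU_of (u m r : ℂ) (h : r ^ 2 = r * (m + (κ - 2) * u - 1) + u * m) :
    cU (Surf.of u m r h) = u := rfl

@[simp]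
theorem cM_of (u m r : ℂ) (h : r ^ 2 = r * (m + (κ - 2) * u - 1) + u * m) :
    cM (Surf.of u m r h) = m := rfl

@[simp]
theorem cR_of (u m r : ℂ) (h : r ^ 2 = r * (m + (κ - 2) * u - 1) + u * m) :
    cR (Surf.of u m r h) = r := rfl

theorem Surf.ext_coord {x y : Surf κ} (hu : cU x = cU y) (hm : cM x = cM y) (hr : cR x = cR y) :
    x = y :=
  Subtype.ext (Prod.ext hu (Prod.ext hm hr))

theorem Surf.rel (x : Surf κ) : cR x ^ 2 = cR x * (cM x + (κ - 2) * cU x - 1) + cU x * cM x := x.2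

/-- The first of the two identified lines. -/
def lineA (κ τ : ℂ) : Surf κ := .of 0 (τ + 1) τ (by ring)

/-- The second of the two identified lines. -/
def lineB (κ τ : ℂ) : Surf κ := .of 0 τ 0 (by ring)

/-- The regular functions on the affine surface. -/
def regFun (κ : ℂ) : Subalgebra ℂ (Surf κ → ℂ) := Algebra.adjoin ℂ {cU, cM, cR}

theorem cU_mem : cU ∈ regFun κ := Algebra.subset_adjoin (by simp)

theorem cM_mem : cM ∈ regFun κ := Algebra.subset_adjoin (by simp)

theorem cR_mem : cR ∈ regFun κ := Algebra.subset_adjoin (by simp)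

theorem cR_mul_cR : (cR * cR : Surf κ → ℂ) = cR * (cM + (κ - 2) • cU - 1) + cU * cM := by
  funext x
  simp only [Pi.mul_apply, Pi.add_apply, Pi.sub_apply, Pi.smul_apply, Pi.one_apply, smul_eq_mul]
  rw [← x.rel, sq]

/-- The equation of the surface is monic quadratic in `r`, so `1` and `r` generate the regular
functions over `ℂ[u, m]`. -/
theorem exists_eq_add_cR_mul {n : Surf κ → ℂ} (hn : n ∈ regFun κ) :
    ∃ a ∈ Algebra.adjoin ℂ {cU, cM}, ∃ b ∈ Algebra.adjoin ℂ {cU, cM}, n = a + cR * b := by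
  set S : Subalgebra ℂ (Surf κ → ℂ) := Algebra.adjoin ℂ {cU, cM} with hS
  have hu : cU ∈ S := Algebra.subset_adjoin (by simp)
  have hm : cM ∈ S := Algebra.subset_adjoin (by simp)
  induction hn using Algebra.adjoin_induction with
  | mem x hx =>
    rcases hx with rfl | rfl | rfl
    · exact ⟨_, hu, 0, zero_mem _, by simp⟩
    · exact ⟨_, hm, 0, zero_mem _, by simp⟩
    · exact ⟨0, zero_mem _, 1, one_mem _, by simp⟩
  | algebraMap z => exact ⟨_, S.algebraMap_mem z, 0, zero_mem _, by simp⟩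
  | add x y _ _ hx hy =>
    obtain ⟨a, ha, b, hb, rfl⟩ := hx
    obtain ⟨a', ha', b', hb', rfl⟩ := hy
    exact ⟨_, add_mem ha ha', _, add_mem hb hb', by ring⟩
  | mul x y _ _ hx hy =>
    obtain ⟨a, ha, b, hb, rfl⟩ := hx
    obtain ⟨a', ha', b', hb', rfl⟩ := hy
    refine ⟨a * a' + cU * cM * (b * b'), ?_, a * b' + a' * b + (cM + (κ - 2) • cU - 1) * (b * b'),
      ?_, ?_⟩
    · exact add_mem (mul_mem ha ha') (mul_mem (mul_mem hu hm) (mul_mem hb hb'))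
    · exact add_mem (add_mem (mul_mem ha hb') (mul_mem ha' hb)) (mul_mem (sub_mem
        (add_mem hm (S.smul_mem hu _)) (one_mem _)) (mul_mem hb hb'))
    · linear_combination (b * b') * cR_mul_cR

/-- The polynomial `a` in the coordinate `m`. -/
def polyM (κ : ℂ) (a : Polynomial ℂ) : Surf κ → ℂ := fun x => a.eval (cM x)

/-- Modulo `u` the equation becomes `r² = r (m - 1)`, so only `a(m) + r b(m)` survives. -/
theorem exists_eq_polyM_add {n : Surf κ → ℂ} (hn : n ∈ regFun κ) :
    ∃ a b : Polynomial ℂ, ∃ n' ∈ regFun κ, n = polyM κ a + cR * polyM κ b + cU * n' := by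
  have hadd : ∀ a b, polyM κ (a + b) = polyM κ a + polyM κ b := fun a b => by
    funext x; simp [polyM]
  have hmul : ∀ a b, polyM κ (a * b) = polyM κ a * polyM κ b := fun a b => by
    funext x; simp [polyM]
  have hX : polyM κ Polynomial.X = cM := by funext x; simp [polyM]
  have h1 : polyM κ 1 = 1 := by funext x; simp [polyM]
  have h0 : polyM κ 0 = 0 := by funext x; simp [polyM]
  have hmem : ∀ a, polyM κ a ∈ regFun κ := by
    intro a
    have : polyM κ a = Polynomial.aeval (cM : Surf κ → ℂ) a := by
      funext x
      induction a using Polynomial.induction_on' with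
      | add p q hp hq => simp [hadd, hp, hq]
      | monomial n z => simp [polyM]
    rw [this]
    exact Algebra.adjoin_mono (by simp) (Polynomial.aeval_mem_adjoin_singleton ℂ _)
  induction hn using Algebra.adjoin_induction with
  | mem x hx =>
    rcases hx with rfl | rfl | rfl
    · exact ⟨0, 0, 1, one_mem _, by simp [h0]⟩
    · exact ⟨Polynomial.X, 0, 0, zero_mem _, by simp [h0, hX]⟩
    · exact ⟨0, 1, 0, zero_mem _, by simp [h0, h1]⟩
  | algebraMap z =>
    refine ⟨Polynomial.C z, 0, 0, zero_mem _, ?_⟩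
    funext x
    simp [polyM]
  | add x y _ _ hx hy =>
    obtain ⟨a, b, n, hn, rfl⟩ := hx
    obtain ⟨a', b', n', hn', rfl⟩ := hy
    exact ⟨a + a', b + b', n + n', add_mem hn hn', by rw [hadd, hadd]; ring⟩
  | mul x y _ _ hx hy =>
    obtain ⟨a, b, n, hn, rfl⟩ := hx
    obtain ⟨a', b', n', hn', rfl⟩ := hy
    -- The term with `X - 1` comes from `r² b b'`; the multiple of `u` in the relation, `u ((κ - 2)
    -- r + m)`, goes into the last component.
    refine ⟨a * a', a * b' + a' * b + (Polynomial.X - 1) * (b * b'),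
      (polyM κ a + cR * polyM κ b + cU * n) * n' + n * (polyM κ a' + cR * polyM κ b') +
        (cR * (κ - 2) • 1 + cM) * (polyM κ b * polyM κ b'), ?_, ?_⟩
    · exact add_mem (add_mem (mul_mem (add_mem (add_mem (hmem _) (mul_mem cR_mem (hmem _)))
        (mul_mem cU_mem hn)) hn') (mul_mem hn (add_mem (hmem _) (mul_mem cR_mem (hmem _)))))
        (mul_mem (add_mem (mul_mem cR_mem ((regFun κ).smul_mem (one_mem _) _)) cM_mem)
          (mul_mem (hmem _) (hmem _)))
    · have hX1 : polyM κ (Polynomial.X - 1) = cM - 1 := by funext x; simp [polyM]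
      have hk : ((κ - 2) • cU : Surf κ → ℂ) = cU * (κ - 2) • 1 := by
        rw [mul_smul_comm, mul_one]
      have hR := cR_mul_cR (κ := κ)
      rw [hk] at hR
      rw [hadd, hadd, hmul, hmul, hmul, hmul, hmul, hX1]
      linear_combination (polyM κ b * polyM κ b') * hR

end Surface

/-! ### The module generated by Baker-Akhiezer functions -/

section Module

variable {W : Opens (ℂ × ℂ)} {β c γ : ℂ × ℂ} {κ Lam : ℂ}

/-- The function `μ² r + μ (m - 2 r) + (1 - m + r - κ u)` on the surface. -/
def eta (W : Opens (ℂ × ℂ)) (c : ℂ × ℂ) (Lam : ℂ) (x : Surf κ) : holo W :=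
  cR x • mult W c Lam ^ 2 + (cM x - 2 * cR x) • mult W c Lam ^ 1 +
    (1 - cM x + cR x - κ * cU x) • mult W c Lam ^ 0

/-- The exponential at a point of the surface. -/
def waveAt (W : Opens (ℂ × ℂ)) (β c γ : ℂ × ℂ) (x : Surf κ) : holo W :=
  wave W β c γ (cU x) (cM x)

/-- From the second line to the first, `m` grows by one and the exponential gains `exp (c₁ x + c₂
y)`, which `mult` cancels up to `Lam`. Gluing by `Lam` thus becomes gluing of prefactors by `mult`.
-/
theorem mult_mul_waveAt_lineA (τ : ℂ) :
    mult W c Lam * waveAt W β c γ (lineA κ τ) = Lam • waveAt W β c γ (lineB κ τ) := by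
  have := mult_pow_mul_wave (W := W) (β := β) (c := c) (γ := γ) Lam 0 (τ + 1) 1
  rw [pow_one, pow_one] at this
  refine this.trans ?_
  change _ = Lam • expo W _
  congr 2
  change _ = β + τ • c + (0 : ℂ) • γ
  push_cast
  module

theorem eta_eq (x : Surf κ) :
    eta W c Lam x = cR x • (mult W c Lam - 1) ^ 2 + cM x • (mult W c Lam - 1) +
      (1 - κ * cU x) • 1 := by
  simp only [eta, Algebra.smul_def, map_sub, map_add, map_mul, map_one, map_ofNat]
  ring

theorem opU_eta_mul_waveAt (h : c.1 * γ.2 - c.2 * γ.1 ≠ 0) (x : Surf κ) :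
    opU W β c γ (eta W c Lam x * waveAt W β c γ x) =
      cU x • (eta W c Lam x * waveAt W β c γ x) := by
  simp only [eta, waveAt, add_mul, smul_mul_assoc, map_add, map_smul, opU_mult_pow_mul_wave h,
    smul_add]
  rw [smul_comm (cR x), smul_comm (cM x - _), smul_comm (1 - _ + _ - _ : ℂ)]

/-- A space of functions on the surface that is stable under differential operators. -/
def IsStable (T : Submodule ℂ (Surf κ → holo W)) : Prop :=
  ∀ E ∈ diffOp W, ∀ Ψ ∈ T, (fun x => E (Ψ x)) ∈ T

theorem IsStable.mul_mem {T : Submodule ℂ (Surf κ → holo W)} (hT : IsStable T) (g : holo W)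
    {Ψ : Surf κ → holo W} (hΨ : Ψ ∈ T) : (fun x => g * Ψ x) ∈ T :=
  hT _ (mulLeft_mem_diffOp g) _ hΨ

section Stable

variable {T : Submodule ℂ (Surf κ → holo W)}

theorem cU_cM_mul_mem
    (hT : IsStable T) (h : c.1 * γ.2 - c.2 * γ.1 ≠ 0)
    {a : Surf κ → ℂ} (ha : a ∈ Algebra.adjoin ℂ {cU, cM}) (b : Surf κ → ℂ)
    (hb : (fun x => b x • waveAt W β c γ x) ∈ T) :
    (fun x => (a * b) x • waveAt W β c γ x) ∈ T := by
  induction ha using Algebra.adjoin_induction generalizing b with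
  | mem a ha =>
    rcases ha with rfl | rfl
    · convert hT _ (opU_mem_diffOp (β := β) (c := c) (γ := γ)) _ hb using 2 with x
      rw [map_smul, waveAt, opU_wave h, smul_smul, Pi.mul_apply, mul_comm]
    · convert hT _ (opM_mem_diffOp (β := β) (c := c) (γ := γ)) _ hb using 2 with x
      rw [map_smul, waveAt, opM_wave h, smul_smul, Pi.mul_apply, mul_comm]
  | algebraMap z =>
    convert T.smul_mem z hb using 1
    funext x
    simp [mul_smul]
  | add a a' _ _ ha ha' =>
    convert T.add_mem (ha b hb) (ha' b hb) using 1
    funext x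
    simp [add_mul, add_smul]
  | mul a a' _ _ ha ha' =>
    rw [mul_assoc]
    exact ha _ (ha' b hb)

theorem cU_mul_mem_of_adjoin
    (hT : IsStable T) (h : c.1 * γ.2 - c.2 * γ.1 ≠ 0)
    (hu : (fun x => cU x • waveAt W β c γ x) ∈ T)
    {a : Surf κ → ℂ} (ha : a ∈ Algebra.adjoin ℂ {cU, cM}) :
    (fun x => (a * cU : Surf κ → ℂ) x • waveAt W β c γ x) ∈ T := cU_cM_mul_mem hT h ha cU hu

/-- Apart from `(μ - 1)² u r`, the expansion of `u η` in powers of `μ - 1` has terms in `u ℂ[u, m]`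
only; dividing by the unit `(μ - 1)²` isolates `u r`. -/
theorem cU_mul_cR_mem
    (hT : IsStable T) (h : c.1 * γ.2 - c.2 * γ.1 ≠ 0) (hε : IsUnit (mult W c Lam - 1))
    (hu : (fun x => cU x • waveAt W β c γ x) ∈ T)
    (hη : (fun x => eta W c Lam x * waveAt W β c γ x) ∈ T) :
    (fun x => (cU * cR : Surf κ → ℂ) x • waveAt W β c γ x) ∈ T := by
  have h1 := hT _ (opU_mem_diffOp (β := β) (c := c) (γ := γ)) _ hη
  have h2 := cU_mul_mem_of_adjoin hT h hu (a := cM) (Algebra.subset_adjoin (by simp))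
  have h3 := cU_mul_mem_of_adjoin hT h hu (a := 1 - κ • cU)
    (sub_mem (one_mem _) (Subalgebra.smul_mem _ (Algebra.subset_adjoin (by simp)) _))
  obtain ⟨ν, hν⟩ := hε.exists_left_inv
  convert hT.mul_mem (ν ^ 2) (T.sub_mem (T.sub_mem h1 (hT.mul_mem (mult W c Lam - 1) h2)) h3)
    using 1
  funext x
  simp only [Pi.sub_apply, opU_eta_mul_waveAt h, Pi.mul_apply, Pi.smul_apply, Pi.one_apply,
    smul_eq_mul]
  simp only [eta_eq, Algebra.smul_def, map_sub, map_mul, map_one]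
  linear_combination (-(ν * (mult W c Lam - 1) + 1) * algebraMap ℂ _ (cU x) *
    algebraMap ℂ _ (cR x) * waveAt W β c γ x) * hν

theorem cU_mul_mem
    (hT : IsStable T) (h : c.1 * γ.2 - c.2 * γ.1 ≠ 0) (hε : IsUnit (mult W c Lam - 1))
    (hu : (fun x => cU x • waveAt W β c γ x) ∈ T)
    (hη : (fun x => eta W c Lam x * waveAt W β c γ x) ∈ T)
    {n : Surf κ → ℂ} (hn : n ∈ regFun κ) :
    (fun x => (cU * n : Surf κ → ℂ) x • waveAt W β c γ x) ∈ T := by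
  obtain ⟨a, ha, b, hb, rfl⟩ := exists_eq_add_cR_mul hn
  convert T.add_mem (cU_mul_mem_of_adjoin hT h hu ha)
    (cU_cM_mul_mem hT h hb _ (cU_mul_cR_mem hT h hε hu hη)) using 1
  funext x
  rw [Pi.add_apply, ← add_smul]
  refine congrArg (fun z : ℂ => z • _) ?_
  simp only [Pi.mul_apply, Pi.add_apply]
  ring

/-- This is the `j`-th power of `opM` applied to `η e`: the terms with `μ²`, `μ`, `1` have
eigenvalues `m - 2`, `m - 1`, `m`. -/
theorem shift_pow_mem
    (hT : IsStable T) (h : c.1 * γ.2 - c.2 * γ.1 ≠ 0)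
    (hη : (fun x => eta W c Lam x * waveAt W β c γ x) ∈ T)
    (j : ℕ) :
    (fun x => ((cM x - 2) ^ j * cR x) • (mult W c Lam ^ 2 * waveAt W β c γ x) +
      ((cM x - 1) ^ j * (cM x - 2 * cR x)) • (mult W c Lam ^ 1 * waveAt W β c γ x) +
      (cM x ^ j * (1 - cM x + cR x - κ * cU x)) • (mult W c Lam ^ 0 * waveAt W β c γ x)) ∈ T := by
  induction j with
  | zero =>
    convert hη using 2 with x
    simp only [eta, pow_zero, one_mul, add_mul, smul_mul_assoc]
  | succ j ih =>
    convert hT _ (opM_mem_diffOp (β := β) (c := c) (γ := γ)) _ ih using 2 with x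
    simp only [waveAt, map_add, map_smul, opM_mult_pow_mul_wave h, smul_smul]
    refine congrArg₂ _ (congrArg₂ _ (congrArg (fun z : ℂ => z • _) ?_)
      (congrArg (fun z : ℂ => z • _) ?_)) (congrArg (fun z : ℂ => z • _) ?_) <;> push_cast <;> ring

theorem shift_polynomial_mem
    (hT : IsStable T) (h : c.1 * γ.2 - c.2 * γ.1 ≠ 0)
    (hη : (fun x => eta W c Lam x * waveAt W β c γ x) ∈ T)
    (p : Polynomial (holo W)) :
    (fun x => (p.eval (algebraMap ℂ _ (cM x - 2)) * cR x • mult W c Lam ^ 2 +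
      p.eval (algebraMap ℂ _ (cM x - 1)) * (cM x - 2 * cR x) • mult W c Lam ^ 1 +
      p.eval (algebraMap ℂ _ (cM x)) * (1 - cM x + cR x - κ * cU x) • mult W c Lam ^ 0) *
        waveAt W β c γ x) ∈ T := by
  induction p using Polynomial.induction_on' with
  | add p q hp hq =>
    convert T.add_mem hp hq using 1
    funext x
    simp only [Polynomial.eval_add, Pi.add_apply]
    ring
  | monomial n g =>
    convert hT.mul_mem g (shift_pow_mem hT h hη n) using 2 with x
    simp only [Polynomial.eval_monomial, Algebra.smul_def, map_mul, map_pow]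
    ring

/-- A polynomial `p` in `opM` applied to `η e` has the part free of `r` and `u` equal to `μ m p(m -
1) - (m - 1) p(m)`, and `exists_shift_eq` solves for `p`. The polynomial `b` is whatever multiplies
`r` in the result. -/
theorem exists_glued_mem
    (hT : IsStable T) (h : c.1 * γ.2 - c.2 * γ.1 ≠ 0) (hε : IsUnit (mult W c Lam - 1))
    (hu : (fun x => cU x • waveAt W β c γ x) ∈ T)
    (hη : (fun x => eta W c Lam x * waveAt W β c γ x) ∈ T)
    (a : Polynomial (holo W)) (ha : a.eval 1 = mult W c Lam * a.eval 0) :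
    ∃ b : Polynomial (holo W), (fun x => (a.eval (algebraMap ℂ _ (cM x)) +
      cR x • b.eval (algebraMap ℂ _ (cM x))) * waveAt W β c γ x) ∈ T := by
  obtain ⟨p, rfl⟩ := exists_shift_eq _ hε a ha
  refine ⟨Polynomial.C (mult W c Lam ^ 2) * p.comp (Polynomial.X - 2) -
    2 * (Polynomial.C (mult W c Lam) * p.comp (Polynomial.X - 1)) + p, ?_⟩
  have hcu : ∀ p : Polynomial (holo W),
      (fun x => p.eval (algebraMap ℂ _ (cM x)) * (cU x • waveAt W β c γ x)) ∈ T := by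
    intro p
    induction p using Polynomial.induction_on' with
    | add p q hp hq =>
      convert T.add_mem hp hq using 1
      funext x
      simp only [Polynomial.eval_add, Pi.add_apply]
      ring
    | monomial n g =>
      convert hT.mul_mem g (cU_mul_mem_of_adjoin hT h hu (a := cM ^ n)
        (pow_mem (Algebra.subset_adjoin (by simp)) n)) using 2 with x
      simp only [Polynomial.eval_monomial, Algebra.smul_def, map_mul, map_pow, Pi.mul_apply,
        Pi.pow_apply]
      ring
  -- The second summand cancels the term `-κ u p(m)` contributed by `η`.
  convert T.add_mem (shift_polynomial_mem hT h hη p) (hcu (Polynomial.C (algebraMap ℂ _ κ) * p))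
    using 1
  funext x
  simp only [Polynomial.eval_sub, Polynomial.eval_add, Polynomial.eval_mul, Polynomial.eval_C,
    Polynomial.eval_comp, Polynomial.eval_X, Polynomial.eval_one, Polynomial.eval_ofNat,
    Algebra.smul_def, map_sub, map_add, map_mul, map_one, map_ofNat, Pi.add_apply]
  ring

/-- Split `n η` as `a(m) + r b(m)` plus a multiple of `u`. The last term is already in `T`; an
element of `T` with the same `a` exists, and gluing leaves no freedom in `b`. -/
theorem mul_eta_mem
    (hT : IsStable T) (h : c.1 * γ.2 - c.2 * γ.1 ≠ 0) (hε : IsUnit (mult W c Lam - 1))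
    (hu : (fun x => cU x • waveAt W β c γ x) ∈ T)
    (hη : (fun x => eta W c Lam x * waveAt W β c γ x) ∈ T)
    (hglue : ∀ Ψ ∈ T, ∀ τ, Ψ (lineA κ τ) = Lam • Ψ (lineB κ τ))
    {n : Surf κ → ℂ} (hn : n ∈ regFun κ) (hnglue : ∀ τ, n (lineA κ τ) = n (lineB κ τ)) :
    (fun x => n x • (eta W c Lam x * waveAt W β c γ x)) ∈ T := by
  set μ := mult W c Lam with hμ
  have hwave : ∀ τ, μ * waveAt W β c γ (lineA κ τ) = Lam • waveAt W β c γ (lineB κ τ) :=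
    mult_mul_waveAt_lineA
  have hwu : ∀ τ, IsUnit (waveAt W β c γ (lineA κ τ)) := fun τ => isUnit_expo _
  have hglue' : ∀ Φ : Surf κ → holo W, (fun x => Φ x * waveAt W β c γ x) ∈ T → ∀ τ,
      Φ (lineA κ τ) = μ * Φ (lineB κ τ) := by
    intro Φ hΦ τ
    have := hglue _ hΦ τ
    refine (hwu τ).mul_right_cancel (this.trans ?_)
    rw [← mul_smul_comm, ← hwave]
    ring
  obtain ⟨a₂, b₂, n₂, hn₂, h₂⟩ := exists_eq_polyM_add (mul_mem hn cR_mem)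
  obtain ⟨a₁, b₁, n₁, hn₁, h₁⟩ :=
    exists_eq_polyM_add (mul_mem hn (sub_mem cM_mem ((regFun κ).smul_mem cR_mem 2)))
  obtain ⟨a₀, b₀, n₀, hn₀, h₀⟩ :=
    exists_eq_polyM_add (mul_mem hn (sub_mem (add_mem (sub_mem (one_mem _) cM_mem) cR_mem)
      ((regFun κ).smul_mem cU_mem κ)))
  obtain ⟨a, ha⟩ : ∃ a : Polynomial (holo W), a = Polynomial.C (μ ^ 2) * a₂.map (algebraMap ℂ _) +
    Polynomial.C μ * a₁.map (algebraMap ℂ _) + a₀.map (algebraMap ℂ _) := ⟨_, rfl⟩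
  obtain ⟨b, hb⟩ : ∃ b : Polynomial (holo W), b = Polynomial.C (μ ^ 2) * b₂.map (algebraMap ℂ _) +
    Polynomial.C μ * b₁.map (algebraMap ℂ _) + b₀.map (algebraMap ℂ _) := ⟨_, rfl⟩
  have hrest := T.add_mem (T.add_mem (hT.mul_mem (μ ^ 2) (cU_mul_mem hT h hε hu hη hn₂))
    (hT.mul_mem μ (cU_mul_mem hT h hε hu hη hn₁))) (cU_mul_mem hT h hε hu hη hn₀)
  obtain ⟨ρ, hρ⟩ : ∃ ρ : Surf κ → holo W, ρ = fun x => (μ ^ 2 * algebraMap ℂ _ (cU x * n₂ x) +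
    μ * algebraMap ℂ _ (cU x * n₁ x) + algebraMap ℂ _ (cU x * n₀ x)) := ⟨_, rfl⟩
  have hrest' : (fun x => ρ x * waveAt W β c γ x) ∈ T := by
    convert hrest using 1
    funext x
    simp only [hρ, Pi.add_apply, Pi.mul_apply, Algebra.smul_def]
    ring
  have hev : ∀ (p : Polynomial ℂ) (z : ℂ), (p.map (algebraMap ℂ (holo W))).eval (algebraMap ℂ _ z) =
      algebraMap ℂ _ (p.eval z) := fun p z => by rw [Polynomial.eval_map, Polynomial.eval₂_at_apply]
  have hdec : ∀ x : Surf κ, n x • eta W c Lam x = a.eval (algebraMap ℂ _ (cM x)) +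
      cR x • b.eval (algebraMap ℂ _ (cM x)) + ρ x := by
    intro x
    have e₂ := congrArg (algebraMap ℂ (holo W)) (congrFun h₂ x)
    have e₁ := congrArg (algebraMap ℂ (holo W)) (congrFun h₁ x)
    have e₀ := congrArg (algebraMap ℂ (holo W)) (congrFun h₀ x)
    simp only [polyM, Pi.mul_apply, Pi.add_apply, Pi.sub_apply, Pi.smul_apply, Pi.one_apply,
      smul_eq_mul, map_add, map_mul, map_sub, map_one] at e₀ e₁ e₂
    simp only [ha, hb, hρ, eta, ← hμ, Polynomial.eval_add, Polynomial.eval_mul, Polynomial.eval_C,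
      hev, Algebra.smul_def, map_sub, map_add, map_mul, map_one]
    linear_combination μ ^ 2 * e₂ + μ * e₁ + e₀
  -- Compare `n η` on the two lines, where `r = τ` and `r = 0`. At `τ = 0` this is the solvability
  -- condition `a(1) = μ a(0)`.
  have hlin : ∀ τ, a.eval (algebraMap ℂ _ (τ + 1)) + τ • b.eval (algebraMap ℂ _ (τ + 1)) =
      μ * a.eval (algebraMap ℂ _ τ) := by
    intro τ
    have hA := hdec (lineA κ τ)
    have hB := hdec (lineB κ τ)
    have hg := hglue' (eta W c Lam) hη τ
    have hr := hglue' ρ hrest' τ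
    rw [hnglue, hg, hr] at hA
    have hcB : cR (lineB κ τ) = 0 := rfl
    rw [hcB, zero_smul, add_zero] at hB
    change _ = a.eval (algebraMap ℂ _ (τ + 1)) + τ • b.eval (algebraMap ℂ _ (τ + 1)) + _ at hA
    change _ = a.eval (algebraMap ℂ _ τ) + _ at hB
    rw [mul_comm μ, ← smul_mul_assoc, hB] at hA
    linear_combination -hA
  obtain ⟨b', hb'⟩ := exists_glued_mem hT h hε hu hη a (by
    have := hlin 0
    rwa [zero_smul, add_zero, zero_add, map_one, map_zero] at this)
  have hbb : b' = b := by
    rw [← sub_eq_zero]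
    -- On the first line `r = m - 1`, so gluing determines `b` at every `m` except `1`.
    refine polynomial_eq_zero _ {1}ᶜ (Set.finite_singleton _).infinite_compl fun τ hτ => ?_
    have h1 := hglue' _ hb' (τ - 1)
    have h2 := hlin (τ - 1)
    change a.eval (algebraMap ℂ _ (τ - 1 + 1)) + (τ - 1) • b'.eval (algebraMap ℂ _ (τ - 1 + 1)) =
      μ * (a.eval (algebraMap ℂ _ (τ - 1)) + (0 : ℂ) • _) at h1
    rw [sub_add_cancel, zero_smul, add_zero, ← h2, sub_add_cancel, add_right_inj] at h1
    rw [Polynomial.eval_sub, sub_eq_zero]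
    exact smul_right_injective _ (sub_ne_zero.2 hτ) h1
  rw [hbb] at hb'
  convert T.add_mem hb' hrest' using 1
  funext x
  rw [Pi.add_apply, ← smul_mul_assoc, hdec]
  ring

end Stable

end Module

/-! ### Uniqueness and existence of matrix operators -/

section Spectral

variable {W : Opens (ℂ × ℂ)} {β c γ : ℂ × ℂ} {κ Lam : ℂ}

-- The excluded locus `u m disc = 0`, with `disc` the discriminant of the surface equation in `r`,
-- is where two distinct nonzero values of `r` over `(u, m)` are not guaranteed.
open MvPolynomial in
theorem eq_zero_of_apply_wave (h : c.1 * γ.2 - c.2 * γ.1 ≠ 0) {E : Module.End ℂ (holo W)}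
    (hE : E ∈ diffOp W)
    (hker : ∀ u m : ℂ, u ≠ 0 → m ≠ 0 → (m + (κ - 2) * u - 1) ^ 2 + 4 * (u * m) ≠ 0 →
      E (wave W β c γ u m) = 0) : E = 0 := by
  refine eq_zero_of_apply_eigen _ _ ?_ hE (fun u m => wave W β c γ u m)
    (fun u m q => Complex.exp_ne_zero _) (fun u m => opU_wave h u m) (fun u m => opM_wave h u m)
    (X 0 * X 1 * ((X 1 + C (κ - 2) * X 0 - 1) ^ 2 + 4 * (X 0 * X 1))) ?_ ?_
  · intro x
    -- The directions of `opU` and `opM` are the basis dual to `γ, c`, so the coordinates of `x` are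
    -- its pairings with `γ` and `c`.
    refine ⟨x.1 * γ.1 + x.2 * γ.2, x.1 * c.1 + x.2 * c.2, ?_⟩
    obtain ⟨d, hd⟩ : ∃ d, d = c.1 * γ.2 - c.2 * γ.1 := ⟨_, rfl⟩
    rw [← hd] at h ⊢
    ext <;> simp only [Prod.fst_add, Prod.snd_add, Prod.smul_fst, Prod.smul_snd, smul_eq_mul] <;>
      field_simp <;> rw [hd] <;> ring
  · refine mul_ne_zero (mul_ne_zero (X_ne_zero _) (X_ne_zero _)) fun h0 => ?_
    simpa using congrArg (eval 0) h0
  · intro u m hZ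
    simp only [map_mul, map_add, map_pow, map_sub, eval_X, eval_C, map_one, map_ofNat,
      Matrix.cons_val_zero, Matrix.cons_val_one, mul_ne_zero_iff] at hZ
    exact hker u m hZ.1.1 hZ.1.2 hZ.2

/-- Two points over the same `(u, m)` share `u e`, while their values of `η` differ by `(r - s) (μ -
1)²`. Subtracting gives `Q = 0`, and then `P = 0`. Only points with `r ≠ 0` are used, since
`Frame.exists_toSurf` reaches exactly those. -/
theorem eq_zero_of_apply_eta_add (h : c.1 * γ.2 - c.2 * γ.1 ≠ 0)
    (hε : IsUnit (mult W c Lam - 1)) {Q P : Module.End ℂ (holo W)} (hQ : Q ∈ diffOp W)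
    (hP : P ∈ diffOp W)
    (hker : ∀ x : Surf κ, cR x ≠ 0 →
      Q (eta W c Lam x * waveAt W β c γ x) + P (cU x • waveAt W β c γ x) = 0) :
    Q = 0 ∧ P = 0 := by
  have hroots : ∀ u m : ℂ, u ≠ 0 → m ≠ 0 → (m + (κ - 2) * u - 1) ^ 2 + 4 * (u * m) ≠ 0 →
      ∃ r s : ℂ, r ≠ s ∧ r ≠ 0 ∧ s ≠ 0 ∧ r ^ 2 = r * (m + (κ - 2) * u - 1) + u * m ∧
        s ^ 2 = s * (m + (κ - 2) * u - 1) + u * m := by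
    intro u m hu hm hd
    obtain ⟨d, hd2⟩ :=
      IsAlgClosed.exists_pow_nat_eq ((m + (κ - 2) * u - 1) ^ 2 + 4 * (u * m)) two_pos
    have hum := mul_ne_zero hu hm
    have hd0 : d ≠ 0 := by
      rintro rfl
      exact hd (by rw [← hd2]; ring)
    have e1 : ∀ z : ℂ, z ^ 2 = z * (m + (κ - 2) * u - 1) + u * m → z ≠ 0 := by
      rintro z hz rfl
      exact hum (by linear_combination -hz)
    have e2 : ((m + (κ - 2) * u - 1 + d) / 2) ^ 2 =
        (m + (κ - 2) * u - 1 + d) / 2 * (m + (κ - 2) * u - 1) + u * m := by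
      linear_combination hd2 / 4
    have e3 : ((m + (κ - 2) * u - 1 - d) / 2) ^ 2 =
        (m + (κ - 2) * u - 1 - d) / 2 * (m + (κ - 2) * u - 1) + u * m := by
      linear_combination hd2 / 4
    exact ⟨_, _, fun h => hd0 (by linear_combination h), e1 _ e2, e1 _ e3, e2, e3⟩
  obtain ⟨ν, hν⟩ := hε.exists_left_inv
  have hQ0 : Q = 0 := by
    have h0 : Q * LinearMap.mulLeft ℂ ((mult W c Lam - 1) ^ 2) = 0 := by
      refine eq_zero_of_apply_wave (β := β) (κ := κ) h
        ((diffOp W).mul_mem hQ (mulLeft_mem_diffOp _)) fun u m hu hm hd => ?_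
      obtain ⟨r, s, hrs, hr0, hs0, hr, hs⟩ := hroots u m hu hm hd
      have h1 := hker (.of u m r hr) hr0
      have h2 := hker (.of u m s hs) hs0
      have h3 : Q ((r - s) • ((mult W c Lam - 1) ^ 2 * wave W β c γ u m)) = 0 := by
        have : (r - s) • ((mult W c Lam - 1) ^ 2 * wave W β c γ u m) =
            eta W c Lam (.of u m r hr : Surf κ) * waveAt W β c γ (.of u m r hr : Surf κ) -
            eta W c Lam (.of u m s hs : Surf κ) * waveAt W β c γ (.of u m s hs : Surf κ) := by
          rw [eta_eq, eta_eq]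
          simp only [waveAt, cU_of, cM_of, cR_of, Algebra.smul_def, map_sub]
          ring
        rw [this, map_sub, sub_eq_zero]
        exact add_right_cancel (h1.trans h2.symm)
      rw [map_smul] at h3
      exact (smul_eq_zero.1 h3).resolve_left (sub_ne_zero.2 hrs)
    refine LinearMap.ext fun g => ?_
    -- Multiplication by `(μ - 1)²` is onto, as `ν` inverts `μ - 1`.
    have := LinearMap.congr_fun h0 (ν ^ 2 * g)
    rw [Module.End.mul_apply, LinearMap.mulLeft_apply] at this
    refine Eq.trans ?_ this
    congr 1
    linear_combination (-(ν * (mult W c Lam - 1) + 1) * g) * hν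
  refine ⟨hQ0, eq_zero_of_apply_wave (β := β) (κ := κ) h hP fun u m hu hm hd => ?_⟩
  obtain ⟨r, _, -, hr0, -, hr, -⟩ := hroots u m hu hm hd
  have h1 := hker (.of u m r hr) hr0
  rw [hQ0, LinearMap.zero_apply, zero_add, map_smul] at h1
  exact (smul_eq_zero.1 h1).resolve_left hu

/-- The function on the surface with coordinates `H j` with respect to `eta` and `u`. -/
def basisFun (β c γ : ℂ × ℂ) (Lam : ℂ) (H : Matrix (Fin 2) (Fin 2) (holo W)) (x : Surf κ) :
    Fin 2 → holo W :=
  fun j => (H j 0 * eta W c Lam x + cU x • H j 1) * waveAt W β c γ x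

variable {H : Matrix (Fin 2) (Fin 2) (holo W)}

/-- Collecting coefficients of `η e` and `u e` composes the row with `H` on the right, which an
inverse of `H` undoes. -/
theorem row_eq_zero (h : c.1 * γ.2 - c.2 * γ.1 ≠ 0) (hε : IsUnit (mult W c Lam - 1))
    (hH : IsUnit H) (P : Fin 2 → diffOp W)
    (hker : ∀ x : Surf κ, cR x ≠ 0 →
      ∑ j, (P j : Module.End ℂ (holo W)) (basisFun β c γ Lam H x j) = 0) (i : Fin 2) :
    P i = 0 := by
  obtain ⟨K, hK⟩ := hH.exists_right_inv
  have hQ : ∀ k, ∑ j, (P j : Module.End ℂ (holo W)) * LinearMap.mulLeft ℂ (H j k) ∈ diffOp W :=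
    fun k => (diffOp W).sum_mem fun j _ => (diffOp W).mul_mem (P j).2 (mulLeft_mem_diffOp _)
  have h0 := eq_zero_of_apply_eta_add (β := β) (κ := κ) h hε (hQ 0) (hQ 1) (by
    intro x hx
    rw [← hker x hx, LinearMap.sum_apply, LinearMap.sum_apply, ← Finset.sum_add_distrib]
    refine Finset.sum_congr rfl fun j _ => ?_
    simp only [Module.End.mul_apply, LinearMap.mulLeft_apply, basisFun]
    rw [← map_add]
    congr 1
    simp only [Algebra.smul_def]
    ring)
  refine Subtype.ext (LinearMap.ext fun g => ?_)
  have e0 := LinearMap.congr_fun h0.1 (K 0 i * g)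
  have e1 := LinearMap.congr_fun h0.2 (K 1 i * g)
  rw [LinearMap.sum_apply] at e0 e1
  have e2 := congrArg₂ (· + ·) e0 e1
  simp only [LinearMap.zero_apply, add_zero, Module.End.mul_apply, LinearMap.mulLeft_apply] at e2
  rw [← Finset.sum_add_distrib] at e2
  refine Eq.trans ?_ e2
  have hK' : ∀ j, H j 0 * (K 0 i * g) + H j 1 * (K 1 i * g) =
      (1 : Matrix _ _ (holo W)) j i * g := by
    intro j
    rw [← hK, Matrix.mul_apply, Fin.sum_univ_two]
    ring
  simp only [← map_add, hK', Matrix.one_apply]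
  rw [Finset.sum_eq_single i (fun j _ hj => by simp [hj]) (by simp)]
  simp

theorem matrix_eq_of_act_eq (h : c.1 * γ.2 - c.2 * γ.1 ≠ 0) (hε : IsUnit (mult W c Lam - 1))
    (hH : IsUnit H) (B B' : Matrix (Fin 2) (Fin 2) (diffOp W))
    (hBB' : ∀ x : Surf κ, cR x ≠ 0 →
      act B (basisFun β c γ Lam H x) = act B' (basisFun β c γ Lam H x)) : B = B' := by
  ext1 i j
  have := row_eq_zero (β := β) (κ := κ) h hε hH
    (fun j => B i j + ((-1 : ℂ) • B' i j)) (fun x hx => by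
    have := congrFun (hBB' x hx) i
    simp only [act] at this
    simp only [Subalgebra.coe_add, Subalgebra.coe_smul, LinearMap.add_apply, LinearMap.smul_apply,
      neg_smul, one_smul, Finset.sum_add_distrib, Finset.sum_neg_distrib, this, add_neg_cancel]) j
  have h2 := congrArg (fun F => F + B' i j) this
  simp only [add_assoc, zero_add] at h2
  rw [← h2, ← one_smul ℂ (B' i j), smul_smul, ← add_smul]
  simp

theorem exists_matrix_act (h : c.1 * γ.2 - c.2 * γ.1 ≠ 0) (hε : IsUnit (mult W c Lam - 1))
    (hH : IsUnit H)
    (hglue : ∀ τ, basisFun β c γ Lam H (lineA κ τ) = Lam • basisFun β c γ Lam H (lineB κ τ))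
    {n : Surf κ → ℂ} (hn : n ∈ regFun κ) (hnglue : ∀ τ, n (lineA κ τ) = n (lineB κ τ)) :
    ∃ B : Matrix (Fin 2) (Fin 2) (diffOp W), ∀ x,
      act B (basisFun β c γ Lam H x) = n x • basisFun β c γ Lam H x := by
  -- `T` is the left `𝒟`-module spanned by the two functions; a witness that `n` times the `i`-th
  -- function lies in `T` is the `i`-th row of the matrix.
  let T : Submodule ℂ (Surf κ → holo W) :=
    { carrier := {Ψ | ∃ P : Fin 2 → diffOp W, Ψ = fun x =>
        ∑ j, (P j : Module.End ℂ (holo W)) (basisFun β c γ Lam H x j)}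
      zero_mem' := ⟨0, by funext x; simp⟩
      add_mem' := by
        rintro _ _ ⟨P, rfl⟩ ⟨P', rfl⟩
        refine ⟨P + P', ?_⟩
        funext x
        simp [Finset.sum_add_distrib]
      smul_mem' := by
        rintro z _ ⟨P, rfl⟩
        refine ⟨z • P, ?_⟩
        funext x
        simp }
  have hT : IsStable T := by
    rintro E hE _ ⟨P, rfl⟩
    refine ⟨fun j => ⟨E, hE⟩ * P j, ?_⟩
    funext x
    simp
  obtain ⟨K, hK⟩ := hH.exists_left_inv
  have hKH : ∀ i k, K i 0 * H 0 k + K i 1 * H 1 k = (1 : Matrix _ _ (holo W)) i k := by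
    intro i k
    rw [← hK, Matrix.mul_apply, Fin.sum_univ_two]
  have hmem : ∀ i, (fun x => ∑ j, K i j * basisFun β c γ Lam H x j) ∈ T := fun i =>
    ⟨fun j => ⟨_, mulLeft_mem_diffOp (K i j)⟩, by funext x; simp⟩
  have hη : (fun x => eta W c Lam x * waveAt W β c γ x) ∈ T := by
    convert hmem 0 using 2 with x
    have h0 := hKH 0 0
    have h1 := hKH 0 1
    simp only [Matrix.one_apply] at h0 h1
    simp only [basisFun, Fin.sum_univ_two, Algebra.smul_def]
    simp at h0 h1
    linear_combination -(eta W c Lam x * waveAt W β c γ x) * h0 -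
      (algebraMap ℂ (holo W) (cU x) * waveAt W β c γ x) * h1
  have hu : (fun x => cU x • waveAt W β c γ x) ∈ T := by
    convert hmem 1 using 2 with x
    have h0 := hKH 1 0
    have h1 := hKH 1 1
    simp only [Matrix.one_apply] at h0 h1
    simp only [basisFun, Fin.sum_univ_two, Algebra.smul_def]
    simp at h0 h1
    linear_combination -(eta W c Lam x * waveAt W β c γ x) * h0 -
      (algebraMap ℂ (holo W) (cU x) * waveAt W β c γ x) * h1
  have hTglue : ∀ Ψ ∈ T, ∀ τ, Ψ (lineA κ τ) = Lam • Ψ (lineB κ τ) := by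
    rintro _ ⟨P, rfl⟩ τ
    simp only [hglue, Pi.smul_apply, map_smul, Finset.smul_sum]
  have h1 := mul_eta_mem hT h hε hu hη hTglue hn hnglue
  have h2 := cU_mul_mem hT h hε hu hη hn
  have h3 : ∀ i, (fun x => n x • basisFun β c γ Lam H x i) ∈ T := by
    intro i
    convert T.add_mem (hT.mul_mem (H i 0) h1) (hT.mul_mem (H i 1) h2) using 1
    funext x
    simp only [basisFun, Pi.add_apply, Pi.mul_apply, Algebra.smul_def, map_mul]
    ring
  choose B hB using h3
  refine ⟨B, fun x => ?_⟩
  funext i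
  exact (congrFun (hB i) x).symm

end Spectral

/-! ### Bihomogeneous holomorphic functions are polynomials -/

section Homogeneous

/-- Liouville's theorem is the case `n = 0`; the divided difference at `0` lowers the growth
exponent by one. -/
theorem exists_sum_pow_of_growth (n : ℕ) {E : ℂ → ℂ} (hE : Differentiable ℂ E) {C : ℝ}
    (hC : ∀ z, 1 ≤ ‖z‖ → ‖E z‖ ≤ C * ‖z‖ ^ n) :
    ∃ a : Fin (n + 1) → ℂ, ∀ z, E z = ∑ i, a i * z ^ (i : ℕ) := by
  induction n generalizing E C with
  | zero =>
    have hb : Bornology.IsBounded (Set.range E) := by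
      obtain ⟨B, hB⟩ := (isCompact_closedBall (0 : ℂ) 1).exists_bound_of_continuousOn
        hE.continuous.continuousOn
      refine isBounded_iff_forall_norm_le.2 ⟨max B C, ?_⟩
      rintro _ ⟨z, rfl⟩
      rcases le_total ‖z‖ 1 with hz | hz
      · exact (hB z (by simpa using hz)).trans (le_max_left _ _)
      · exact (by simpa using hC z hz : ‖E z‖ ≤ C).trans (le_max_right _ _)
    exact ⟨fun _ => E 0, fun z => by simpa using hE.apply_eq_apply_of_bounded hb z 0⟩
  | succ n ih =>
    have hd : Differentiable ℂ (dslope E 0) := by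
      rw [← differentiableOn_univ, Complex.differentiableOn_dslope Filter.univ_mem,
        differentiableOn_univ]
      exact hE
    have hEz : ∀ z, E z = E 0 + z * dslope E 0 z := by
      intro z
      have := sub_smul_dslope E 0 z
      rw [sub_zero, smul_eq_mul] at this
      rw [this]
      ring
    obtain ⟨a, ha⟩ := ih hd (C := C + ‖E 0‖) (fun z hz => by
      have hz0 : 0 < ‖z‖ := by linarith
      have h1 : ‖z‖ * ‖dslope E 0 z‖ ≤ C * ‖z‖ ^ (n + 1) + ‖E 0‖ := by
        rw [← norm_mul, ← sub_eq_iff_eq_add'.2 (hEz z)]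
        exact (norm_sub_le _ _).trans (add_le_add_left (hC z hz) _)
      have h2 : ‖E 0‖ ≤ ‖E 0‖ * ‖z‖ ^ (n + 1) :=
        le_mul_of_one_le_right (norm_nonneg _) (one_le_pow₀ hz)
      refine le_of_mul_le_mul_left (h1.trans ?_) hz0
      calc C * ‖z‖ ^ (n + 1) + ‖E 0‖ ≤ C * ‖z‖ ^ (n + 1) + ‖E 0‖ * ‖z‖ ^ (n + 1) := by linarith
        _ = ‖z‖ * ((C + ‖E 0‖) * ‖z‖ ^ n) := by ring)
    refine ⟨Fin.cons (E 0) a, fun z => ?_⟩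
    rw [hEz, ha, Finset.mul_sum, Fin.sum_univ_succ (n := n + 1)]
    simp only [Fin.cons_zero, Fin.cons_succ, Fin.val_zero, pow_zero, mul_one, Fin.val_succ]
    congr 1
    exact Finset.sum_congr rfl fun i _ => by ring

theorem vec_ne_zero_left {a b : ℂ} (h : a ≠ 0) : (![a, b] : Vec) ≠ 0 := fun h0 =>
  h (by simpa using congrFun h0 0)

theorem vec_ne_zero_right {a b : ℂ} (h : b ≠ 0) : (![a, b] : Vec) ≠ 0 := fun h0 =>
  h (by simpa using congrFun h0 1)

/-- A homogeneous holomorphic function on `ℂ² \ {0}` is a homogeneous polynomial. -/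
theorem exists_homogeneous_sum (n : ℕ) {g : Vec → ℂ} (hg : AnalyticOnNhd ℂ g {v | v ≠ 0})
    (hhom : ∀ v, v ≠ 0 → ∀ a : ℂ, a ≠ 0 → g (a • v) = a ^ n * g v) :
    ∃ a : Fin (n + 1) → ℂ, ∀ v, v ≠ 0 → g v = ∑ i, a i * (v 0 ^ (i : ℕ) * v 1 ^ (n - i)) := by
  have han0 : Differentiable ℂ fun z : ℂ => g ![z, 1] := fun z => by
    refine DifferentiableAt.comp (g := g) z (hg _ (vec_ne_zero_right one_ne_zero)).differentiableAt
      ?_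
    rw [differentiableAt_pi]
    intro i
    fin_cases i
    · exact differentiableAt_id
    · exact differentiableAt_const _
  have han1 : Continuous fun z : ℂ => g ![1, z] := continuous_iff_continuousAt.2 fun z => by
    refine ContinuousAt.comp (g := g) (hg _ (vec_ne_zero_left one_ne_zero)).continuousAt ?_
    rw [continuousAt_pi]
    intro i
    fin_cases i
    · exact continuousAt_const
    · exact continuousAt_id
  have hinv : ∀ z : ℂ, z ≠ 0 → g ![z, 1] = z ^ n * g ![1, z⁻¹] := by
    intro z hz
    rw [← hhom _ (vec_ne_zero_left one_ne_zero) z hz]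
    congr 1
    ext i
    fin_cases i <;> simp [hz]
  obtain ⟨C, hC⟩ := (isCompact_closedBall (0 : ℂ) 1).exists_bound_of_continuousOn
    han1.continuousOn
  -- The other affine chart is bounded on the unit disc, and `g(z, 1) = z ^ n g(1, 1 / z)` turns
  -- this into growth of order `n`.
  obtain ⟨a, ha⟩ := exists_sum_pow_of_growth n han0 (C := C) (fun z hz => by
    have hz0 : z ≠ 0 := by
      rintro rfl
      norm_num at hz
    rw [hinv z hz0, norm_mul, norm_pow, mul_comm]
    refine mul_le_mul_of_nonneg_right (hC _ ?_) (by positivity)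
    rw [mem_closedBall_zero_iff, norm_inv]
    exact inv_le_one_of_one_le₀ hz)
  have hpoly : ∀ z : ℂ, g ![1, z] = ∑ i, a i * z ^ (n - (i : ℕ)) := by
    refine congrFun (Continuous.ext_on (dense_compl_singleton (0 : ℂ)) han1 (by fun_prop) ?_)
    intro z hz
    have hz : z ≠ 0 := hz
    have h1 := hinv z⁻¹ (inv_ne_zero hz)
    rw [ha, inv_inv] at h1
    have h2 : g ![1, z] = z ^ n * ∑ i, a i * z⁻¹ ^ (i : ℕ) := by
      rw [h1, ← mul_assoc, ← mul_pow, mul_inv_cancel₀ hz, one_pow, one_mul]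
    refine h2.trans ?_
    rw [Finset.mul_sum]
    refine Finset.sum_congr rfl fun i _ => ?_
    rw [← pow_sub_mul_pow z (Nat.le_of_lt_succ i.2), inv_pow]
    field_simp
  refine ⟨a, fun v hv => ?_⟩
  by_cases h1 : v 0 = 0
  · have h2 : v 1 ≠ 0 := fun h2 => hv (by ext i; fin_cases i; exacts [h1, h2])
    have hv' : v = v 1 • ![0, 1] := by
      ext i
      fin_cases i <;> simp [h1]
    conv_lhs => rw [hv']
    rw [hhom _ (vec_ne_zero_right one_ne_zero) _ h2, ha, h1, Finset.mul_sum]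
    refine Finset.sum_congr rfl fun i _ => ?_
    rcases Nat.eq_zero_or_pos i with hi | hi
    · simp [hi, mul_comm]
    · simp [hi.ne']
  · have hv' : v = v 0 • ![1, v 1 / v 0] := by
      ext i
      fin_cases i <;> simp [mul_div_cancel₀, h1]
    conv_lhs => rw [hv']
    rw [hhom _ (vec_ne_zero_left one_ne_zero) _ h1, hpoly, Finset.mul_sum]
    refine Finset.sum_congr rfl fun i _ => ?_
    have hi := Nat.le_of_lt_succ i.2
    rw [← pow_sub_mul_pow (v 0) hi, div_pow]
    field_simp

/-- A bihomogeneous holomorphic function is a bihomogeneous polynomial. -/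
theorem exists_bihomogeneous_sum (n : ℕ) {G : Vec × Vec → ℂ}
    (hG : AnalyticOnNhd ℂ G {q | q.1 ≠ 0 ∧ q.2 ≠ 0})
    (h1 : ∀ v w, v ≠ 0 → w ≠ 0 → ∀ a : ℂ, a ≠ 0 → G (a • v, w) = a ^ n * G (v, w))
    (h2 : ∀ v w, v ≠ 0 → w ≠ 0 → ∀ a : ℂ, a ≠ 0 → G (v, a • w) = a ^ n * G (v, w)) :
    ∃ a : Fin (n + 1) → Fin (n + 1) → ℂ, ∀ v w, v ≠ 0 → w ≠ 0 → G (v, w) =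
      ∑ i, ∑ j, a i j *
        ((v 0 ^ (i : ℕ) * v 1 ^ (n - i)) * (w 0 ^ (j : ℕ) * w 1 ^ (n - j))) := by
  have hc : ∀ w, w ≠ 0 → ∃ a : Fin (n + 1) → ℂ, ∀ v, v ≠ 0 →
      G (v, w) = ∑ i, a i * (v 0 ^ (i : ℕ) * v 1 ^ (n - i)) := fun w hw =>
    exists_homogeneous_sum n (fun v hv => AnalyticAt.comp (g := G) (f := fun v : Vec => (v, w))
      (hG (v, w) ⟨hv, hw⟩) (analyticAt_id.prod analyticAt_const)) fun v hv => h1 v w hv hw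
  -- The coefficients of the polynomial in `v` are recovered from its values at the `n + 1` points
  -- `(k : 1)`, hence are themselves holomorphic and homogeneous in `w`.
  let V : Matrix (Fin (n + 1)) (Fin (n + 1)) ℂ :=
    Matrix.vandermonde fun k : Fin (n + 1) => ((k : ℕ) : ℂ)
  have hV : IsUnit V.det := by
    rw [isUnit_iff_ne_zero, Matrix.det_vandermonde_ne_zero_iff]
    intro i j hij
    exact Fin.ext (Nat.cast_injective hij)
  have hc' : ∀ v w, v ≠ 0 → w ≠ 0 → G (v, w) =
      ∑ i, (∑ k : Fin (n + 1), V⁻¹ i k * G (![((k : ℕ) : ℂ), 1], w)) *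
        (v 0 ^ (i : ℕ) * v 1 ^ (n - i)) := by
    intro v w hv hw
    obtain ⟨a, ha⟩ := hc w hw
    rw [ha v hv]
    refine Finset.sum_congr rfl fun i _ => ?_
    congr 1
    have : (fun k : Fin (n + 1) => G (![((k : ℕ) : ℂ), 1], w)) = V.mulVec a := by
      funext k
      rw [ha _ (vec_ne_zero_right one_ne_zero)]
      simp only [Matrix.mulVec, dotProduct, V, Matrix.vandermonde_apply]
      refine Finset.sum_congr rfl fun i _ => ?_
      simp [mul_comm]
    change a i = (V⁻¹.mulVec fun k : Fin (n + 1) => G (![((k : ℕ) : ℂ), 1], w)) i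
    rw [this, Matrix.mulVec_mulVec, Matrix.nonsing_inv_mul _ hV, Matrix.one_mulVec]
  have hk : ∀ k : Fin (n + 1), ∃ b : Fin (n + 1) → ℂ, ∀ w, w ≠ 0 →
      G (![((k : ℕ) : ℂ), 1], w) = ∑ j, b j * (w 0 ^ (j : ℕ) * w 1 ^ (n - j)) := fun k =>
    exists_homogeneous_sum n (fun w hw => AnalyticAt.comp (g := G)
      (f := fun w : Vec => (![((k : ℕ) : ℂ), 1], w)) (hG (_, w) ⟨vec_ne_zero_right one_ne_zero, hw⟩)
      (analyticAt_const.prod analyticAt_id)) fun w hw => h2 _ w (vec_ne_zero_right one_ne_zero) hw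
  choose b hb using hk
  refine ⟨fun i j => ∑ k, V⁻¹ i k * b k j, fun v w hv hw => ?_⟩
  rw [hc' v w hv hw]
  refine Finset.sum_congr rfl fun i _ => ?_
  simp only [hb _ w hw, Finset.mul_sum, Finset.sum_mul]
  rw [Finset.sum_comm]
  exact Finset.sum_congr rfl fun j _ => Finset.sum_congr rfl fun k _ => by ring

/-- Writes a monomial of degree `n` as a product of exactly `n` linear factors, so that each can be
divided by one factor `f`. -/
theorem prod_range_ite {R : Type*} [CommMonoid R] (a b : R) {n i : ℕ} (hi : i ≤ n) :
    ∏ k ∈ Finset.range n, (if k < i then a else b) = a ^ i * b ^ (n - i) := by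
  obtain ⟨m, rfl⟩ := Nat.exists_eq_add_of_le hi
  rw [Finset.prod_range_add, Finset.prod_congr rfl fun k hk => if_pos (Finset.mem_range.1 hk)]
  simp

end Homogeneous

/-! ### Frames and coordinates on the complement of the curve -/

section Frame

variable {M : Type*} [AddCommGroup M] [Module ℂ M]

/-- The bilinear map with coefficients in a module. -/
def bil (B : Matrix (Fin 2) (Fin 2) M) (v w : Vec) : M := ∑ i, ∑ j, (v i * w j) • B i j

theorem form_eq_bil (B : Matrix (Fin 2) (Fin 2) ℂ) (v w : Vec) : form B v w = bil B v w := by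
  simp only [form, bil, smul_eq_mul, mul_comm]

theorem bil_expand (B : Matrix (Fin 2) (Fin 2) M) (a b a' b' : ℂ) (q p : Vec) :
    bil B (a • q + b • p) (a' • q + b' • p) = (a * a') • bil B q q + (a * b') • bil B q p +
      (b * a') • bil B p q + (b * b') • bil B p p := by
  simp only [bil, Fin.sum_univ_two, Pi.add_apply, Pi.smul_apply, smul_eq_mul]
  module

theorem form_smul_left (B : Matrix (Fin 2) (Fin 2) ℂ) (a : ℂ) (v w : Vec) :
    form B (a • v) w = a * form B v w := by
  simp only [form, Fin.sum_univ_two, Pi.smul_apply, smul_eq_mul]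
  ring

theorem form_smul_right (B : Matrix (Fin 2) (Fin 2) ℂ) (a : ℂ) (v w : Vec) :
    form B v (a • w) = a * form B v w := by
  simp only [form, Fin.sum_univ_two, Pi.smul_apply, smul_eq_mul]
  ring

/-- The first coordinate of `v` in the basis `q, p`. -/
def fstCoord (q p v : Vec) : ℂ := (v 0 * p 1 - v 1 * p 0) / (q 0 * p 1 - q 1 * p 0)

/-- The second coordinate of `v` in the basis `q, p`. -/
def sndCoord (q p v : Vec) : ℂ := (q 0 * v 1 - q 1 * v 0) / (q 0 * p 1 - q 1 * p 0)

theorem eq_coord {q p : Vec} (h : q 0 * p 1 - q 1 * p 0 ≠ 0) (v : Vec) :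
    v = fstCoord q p v • q + sndCoord q p v • p := by
  obtain ⟨d, hd⟩ : ∃ d, d = q 0 * p 1 - q 1 * p 0 := ⟨_, rfl⟩
  ext i
  simp only [fstCoord, sndCoord, Pi.add_apply, Pi.smul_apply, smul_eq_mul]
  rw [← hd] at h ⊢
  fin_cases i <;> simp <;> field_simp <;> rw [hd] <;> ring

theorem fstCoord_comb {q p : Vec} (h : q 0 * p 1 - q 1 * p 0 ≠ 0) (a b : ℂ) :
    fstCoord q p (a • q + b • p) = a := by
  rw [fstCoord, div_eq_iff h]
  simp only [Pi.add_apply, Pi.smul_apply, smul_eq_mul]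
  ring

theorem sndCoord_comb {q p : Vec} (h : q 0 * p 1 - q 1 * p 0 ≠ 0) (a b : ℂ) :
    sndCoord q p (a • q + b • p) = b := by
  rw [sndCoord, div_eq_iff h]
  simp only [Pi.add_apply, Pi.smul_apply, smul_eq_mul]
  ring

/-- Homogeneous coordinates `q, p` of the two points that are normalised so that the gluing factor
of `f` is one. -/
structure Frame (f : Matrix (Fin 2) (Fin 2) ℂ) (q p : Vec) : Prop where
  det_ne : q 0 * p 1 - q 1 * p 0 ≠ 0
  glue : ∀ t, form f q t = form f t p
  ne : form f p p ≠ 0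

variable {f : Matrix (Fin 2) (Fin 2) ℂ} {q p : Vec}

/-- The modulus `f(p, q) / f(p, p)` of the glued surface. -/
def modulus (f : Matrix (Fin 2) (Fin 2) ℂ) (q p : Vec) : ℂ := form f p q / form f p p

/-- Gluing at `t = q` and `t = p` makes `f(q, q)`, `f(q, p)` and `f(p, p)` equal; only `f(p, q)`
remains free. -/
theorem Frame.form_comb (F : Frame f q p) (a b a' b' : ℂ) :
    form f (a • q + b • p) (a' • q + b' • p) =
      form f p p * (a * a' + a * b' + modulus f q p * (b * a') + b * b') := by
  have h1 := F.glue q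
  have h2 := F.glue p
  have h3 := F.ne
  rw [form_eq_bil, bil_expand]
  simp only [← form_eq_bil, smul_eq_mul, h1, h2, modulus]
  field_simp

/-- The point of the affine surface with homogeneous coordinates `(v, w)`. -/
def Frame.toSurf (F : Frame f q p) (v w : Vec) (h : form f v w ≠ 0) : Surf (modulus f q p) :=
  .of (form f p p * (sndCoord q p v * fstCoord q p w) / form f v w)
    (form f p p * (2 * (fstCoord q p v * fstCoord q p w) + fstCoord q p v * sndCoord q p w) /
      form f v w)
    (form f p p * (fstCoord q p v * fstCoord q p w) / form f v w) (by
      have h1 := F.form_comb (fstCoord q p v) (sndCoord q p v) (fstCoord q p w) (sndCoord q p w)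
      rw [← eq_coord F.det_ne, ← eq_coord F.det_ne] at h1
      field_simp
      rw [h1]
      ring)

theorem Frame.toSurf_comb (F : Frame f q p) {a b a' b' : ℂ}
    (h : form f (a • q + b • p) (a' • q + b' • p) ≠ 0)
    (h1 : a * a' + a * b' + modulus f q p * (b * a') + b * b' = 1) :
    cU (F.toSurf _ _ h) = b * a' ∧ cM (F.toSurf _ _ h) = 2 * (a * a') + a * b' ∧
      cR (F.toSurf _ _ h) = a * a' := by
  have h2 : form f (a • q + b • p) (a' • q + b' • p) = form f p p := by
    rw [F.form_comb, h1, mul_one]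
  simp only [Frame.toSurf, cU_of, cM_of, cR_of, fstCoord_comb F.det_ne, sndCoord_comb F.det_ne, h2,
    mul_div_cancel_left₀ _ F.ne, and_self]

theorem Frame.exists_toSurf_of_comb (F : Frame f q p) {a b a' b' : ℂ} {x : Surf (modulus f q p)}
    (h1 : a * a' + a * b' + modulus f q p * (b * a') + b * b' = 1)
    (hu : cU x = b * a') (hm : cM x = 2 * (a * a') + a * b') (hr : cR x = a * a') :
    ∃ h : form f (a • q + b • p) (a' • q + b' • p) ≠ 0, F.toSurf _ _ h = x := by
  have h : form f (a • q + b • p) (a' • q + b' • p) ≠ 0 := by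
    rw [F.form_comb, h1, mul_one]
    exact F.ne
  obtain ⟨e1, e2, e3⟩ := F.toSurf_comb h h1
  exact ⟨h, Surf.ext_coord (e1.trans hu.symm) (e2.trans hm.symm) (e3.trans hr.symm)⟩

/-- If `r = a a'` is nonzero, scaling allows `a' = 1`; then `a`, `b` and `b'` can be read off from
`r`, `u` and `m`. -/
theorem Frame.exists_toSurf (F : Frame f q p) {x : Surf (modulus f q p)} (hx : cR x ≠ 0) :
    ∃ (v w : Vec) (h : form f v w ≠ 0), F.toSurf v w h = x := by
  refine ⟨_, _, F.exists_toSurf_of_comb (a := cR x) (b := cU x) (a' := 1)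
    (b' := (cM x - 2 * cR x) / cR x) (x := x) ?_ ?_ ?_ ?_⟩
  · have := x.rel
    field_simp
    linear_combination -this
  · rw [mul_one]
  · field_simp
    ring
  · rw [mul_one]

theorem Frame.toSurf_lineA (F : Frame f q p) (τ : ℂ) :
    ∃ h : form f q (τ • q + (1 - τ) • p) ≠ 0, F.toSurf _ _ h = lineA _ τ := by
  have := F.exists_toSurf_of_comb (a := 1) (b := 0) (a' := τ) (b' := 1 - τ)
    (x := lineA (modulus f q p) τ) (by ring) (by simp [lineA]) (by simp [lineA]; ring)
    (by simp [lineA])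
  rwa [one_smul, zero_smul, add_zero] at this

theorem Frame.toSurf_lineB (F : Frame f q p) (τ : ℂ) :
    ∃ h : form f (τ • q + (1 - τ) • p) p ≠ 0, F.toSurf _ _ h = lineB _ τ := by
  have := F.exists_toSurf_of_comb (a := τ) (b := 1 - τ) (a' := 0) (b' := 1)
    (x := lineB (modulus f q p) τ) (by ring) (by simp [lineB]) (by simp [lineB])
    (by simp [lineB])
  rwa [one_smul, zero_smul, zero_add] at this

/-- The four monomials `a a'`, `a b'`, `b a'`, `b b'`, divided by the normalised `f`, are `r`, `m -
2 r`, `u` and `1 - m + r - κ u`. -/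
theorem Frame.bil_eq (F : Frame f q p) {v w : Vec} (h : form f v w ≠ 0)
    (B : Matrix (Fin 2) (Fin 2) M) :
    (form f v w)⁻¹ • bil B v w = (form f p p)⁻¹ • (cR (F.toSurf v w h) • bil B q q +
      (cM (F.toSurf v w h) - 2 * cR (F.toSurf v w h)) • bil B q p +
      cU (F.toSurf v w h) • bil B p q +
      (1 - cM (F.toSurf v w h) + cR (F.toSurf v w h) - modulus f q p * cU (F.toSurf v w h)) •
        bil B p p) := by
  have h1 := F.form_comb (fstCoord q p v) (sndCoord q p v) (fstCoord q p w) (sndCoord q p w)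
  have h2 := bil_expand B (fstCoord q p v) (sndCoord q p v) (fstCoord q p w) (sndCoord q p w) q p
  rw [← eq_coord F.det_ne, ← eq_coord F.det_ne] at h1 h2
  have h3 := F.ne
  rw [h2]
  simp only [smul_add, smul_smul, Frame.toSurf, cU_of, cM_of, cR_of]
  congr 1
  · congr 1
    · congr 1
      · congr 1
        field_simp
      · congr 1
        field_simp
        ring
    · congr 1
      field_simp
  · congr 1
    field_simp
    rw [h1]
    ring

theorem exists_bil_eq (h : q 0 * p 1 - q 1 * p 0 ≠ 0) (b₁₁ b₁₂ b₂₁ b₂₂ : M) :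
    ∃ B : Matrix (Fin 2) (Fin 2) M, bil B q q = b₁₁ ∧ bil B q p = b₁₂ ∧ bil B p q = b₂₁ ∧
      bil B p p = b₂₂ := by
  have key : ∀ v w, bil (Matrix.of fun i j : Fin 2 =>
      (fstCoord q p (Pi.single i 1) * fstCoord q p (Pi.single j 1)) • b₁₁ +
      (fstCoord q p (Pi.single i 1) * sndCoord q p (Pi.single j 1)) • b₁₂ +
      (sndCoord q p (Pi.single i 1) * fstCoord q p (Pi.single j 1)) • b₂₁ +
      (sndCoord q p (Pi.single i 1) * sndCoord q p (Pi.single j 1)) • b₂₂) v w =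
      (fstCoord q p v * fstCoord q p w) • b₁₁ + (fstCoord q p v * sndCoord q p w) • b₁₂ +
      (sndCoord q p v * fstCoord q p w) • b₂₁ + (sndCoord q p v * sndCoord q p w) • b₂₂ := by
    intro v w
    have e1 : ∀ v, fstCoord q p v =
        v 0 * fstCoord q p (Pi.single 0 1) + v 1 * fstCoord q p (Pi.single 1 1) := fun v => by
      simp [fstCoord]
      ring
    have e2 : ∀ v, sndCoord q p v =
        v 0 * sndCoord q p (Pi.single 0 1) + v 1 * sndCoord q p (Pi.single 1 1) := fun v => by
      simp [sndCoord]
      ring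
    rw [e1 v, e1 w, e2 v, e2 w]
    simp only [bil, Fin.sum_univ_two, Matrix.of_apply]
    module
  have f1 : fstCoord q p q = 1 := by simpa using fstCoord_comb h 1 0
  have f2 : fstCoord q p p = 0 := by simpa using fstCoord_comb h 0 1
  have s1 : sndCoord q p q = 0 := by simpa using sndCoord_comb h 1 0
  have s2 : sndCoord q p p = 1 := by simpa using sndCoord_comb h 0 1
  refine ⟨_, (key q q).trans ?_, (key q p).trans ?_, (key p q).trans ?_, (key p p).trans ?_⟩ <;>
    simp [f1, f2, s1, s2]

theorem eq_zero_of_bil_eq_zero (h : q 0 * p 1 - q 1 * p 0 ≠ 0) {B : Matrix (Fin 2) (Fin 2) M}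
    (h₁₁ : bil B q q = 0) (h₁₂ : bil B q p = 0) (h₂₁ : bil B p q = 0) (h₂₂ : bil B p p = 0) :
    B = 0 := by
  have hz : ∀ v w, bil B v w = 0 := fun v w => by
    rw [eq_coord h v, eq_coord h w, bil_expand, h₁₁, h₁₂, h₂₁, h₂₂]
    simp
  ext i j
  have := hz (Pi.single i 1) (Pi.single j 1)
  fin_cases i <;> fin_cases j <;> simpa [bil, Fin.sum_univ_two] using this

end Frame

/-! ### Potentials and Baker-Akhiezer functions in a frame -/

theorem eta_lineA {U : Opens (ℂ × ℂ)} {c : ℂ × ℂ} {κ Lam : ℂ} (τ : ℂ) :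
    eta U c Lam (lineA κ τ) = mult U c Lam * eta U c Lam (lineB κ τ) := by
  simp only [eta, lineA, lineB, cU_of, cM_of, cR_of, Algebra.smul_def, map_sub, map_add, map_mul,
    map_one, map_zero, map_ofNat]
  ring

theorem basisFun_lineA {U : Opens (ℂ × ℂ)} {β c γ : ℂ × ℂ} {κ Lam : ℂ}
    (H : Matrix (Fin 2) (Fin 2) (holo U)) (τ : ℂ) :
    basisFun β c γ Lam H (lineA κ τ) = Lam • basisFun β c γ Lam H (lineB κ τ) := by
  funext k
  have hA : cU (lineA κ τ) = 0 := rfl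
  have hB : cU (lineB κ τ) = 0 := rfl
  rw [Pi.smul_apply, basisFun, basisFun, hA, hB, zero_smul, add_zero, add_zero, eta_lineA,
    ← mul_smul_comm, ← mult_mul_waveAt_lineA]
  ring

section FramePsi

variable {f f₁ f₂ : Matrix (Fin 2) (Fin 2) ℂ} {q p : Vec} {c₁ c₂ Lam : ℂ}

/-- The gluing condition of a potential, in terms of its values at the two points. -/
def IsPotAt (f : Matrix (Fin 2) (Fin 2) ℂ) (q p : Vec) (g : Matrix (Fin 2) (Fin 2) ℂ) (c : ℂ) :
    Prop :=
  form g q q - form g q p = c * form f p p ∧ form g q p - form g p p = c * form f p p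

/-- The constant terms of the potentials. -/
def potConst (f f₁ f₂ : Matrix (Fin 2) (Fin 2) ℂ) (p : Vec) : ℂ × ℂ :=
  (form f₁ p p / form f p p, form f₂ p p / form f p p)

/-- The coefficients of `u` in the potentials. -/
def potSlope (f f₁ f₂ : Matrix (Fin 2) (Fin 2) ℂ) (q p : Vec) : ℂ × ℂ :=
  ((form f₁ p q - modulus f q p * form f₁ p p) / form f p p,
    (form f₂ p q - modulus f q p * form f₂ p p) / form f p p)

theorem Frame.isPotAt (F : Frame f q p) {A : ℂ} (hA : A ≠ 0) {g : Matrix (Fin 2) (Fin 2) ℂ} {c : ℂ}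
    (h : IsPotential (A • q) p f g c) : IsPotAt f q p g c := by
  have key : ∀ t, form f t p ≠ 0 → form g q t - form g t p = c * form f t p := by
    intro t ht
    have h1 := h t (by rw [form_smul_left, F.glue]; exact mul_ne_zero hA ht)
    rw [form_smul_left, form_smul_left, F.glue] at h1
    field_simp at h1
    rw [h1, mul_comm]
  have hq : form f q p = form f p p := F.glue p
  exact ⟨by rw [key q (hq ▸ F.ne), hq], key p F.ne⟩

theorem Frame.isPotential (F : Frame f q p) {A : ℂ} (hA : A ≠ 0) {g : Matrix (Fin 2) (Fin 2) ℂ}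
    {c : ℂ} (h : IsPotAt f q p g c) : IsPotential (A • q) p f g c := by
  intro t ht
  rw [form_smul_left, F.glue] at ht
  have ht' := right_ne_zero_of_mul ht
  rw [form_smul_left, form_smul_left, F.glue]
  field_simp
  have h1 := bil_expand g 1 0 (fstCoord q p t) (sndCoord q p t) q p
  have h2 := bil_expand g (fstCoord q p t) (sndCoord q p t) 0 1 q p
  have h3 := F.form_comb (fstCoord q p t) (sndCoord q p t) 0 1
  rw [← eq_coord F.det_ne] at h1 h2 h3
  simp only [one_smul, zero_smul, zero_add, add_zero, ← form_eq_bil, smul_eq_mul] at h1 h2 h3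
  rw [h1, h2, h3]
  linear_combination (fstCoord q p t) * h.1 + (sndCoord q p t) * h.2

/-- The two gluing equations make `g(q, q)`, `g(q, p)`, `g(p, p)` an arithmetic progression, so `r`
drops out and only `m`, `u` and a constant remain. -/
theorem Frame.form_div_eq (F : Frame f q p) {g : Matrix (Fin 2) (Fin 2) ℂ} {c : ℂ}
    (hg : IsPotAt f q p g c) {v w : Vec} (h : form f v w ≠ 0) :
    form g v w / form f v w = form g p p / form f p p + cM (F.toSurf v w h) * c +
      cU (F.toSurf v w h) * ((form g p q - modulus f q p * form g p p) / form f p p) := by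
  have h1 := F.bil_eq h g
  simp only [← form_eq_bil, smul_eq_mul] at h1
  have h2 := F.ne
  rw [div_eq_inv_mul, h1]
  field_simp
  linear_combination (cR (F.toSurf v w h)) * (hg.1 - hg.2) + (cM (F.toSurf v w h)) * hg.2

theorem Frame.expFactor_eq (F : Frame f q p) (U : Opens (ℂ × ℂ)) (h₁ : IsPotAt f q p f₁ c₁)
    (h₂ : IsPotAt f q p f₂ c₂) {v w : Vec} (h : form f v w ≠ 0) :
    expFactor U f f₁ f₂ v w =
      waveAt U (potConst f f₁ f₂ p) (c₁, c₂) (potSlope f f₁ f₂ q p) (F.toSurf v w h) := by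
  change expo U (form f₁ v w / form f v w, form f₂ v w / form f v w) = expo U _
  rw [F.form_div_eq h₁ h, F.form_div_eq h₂ h]
  rfl

/-- If the determinant vanished, a nontrivial combination of the potentials would have no `m` and no
`u` term, hence be a constant `z`: a linear relation among `f₁, f₂, f`. -/
theorem Frame.discr_ne_zero (F : Frame f q p) (h₁ : IsPotAt f q p f₁ c₁) (h₂ : IsPotAt f q p f₂ c₂)
    (hli : LinearIndependent ℂ ![f₁, f₂, f]) :
    (c₁, c₂).1 * (potSlope f f₁ f₂ q p).2 - (c₁, c₂).2 * (potSlope f f₁ f₂ q p).1 ≠ 0 := by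
  intro h0
  obtain ⟨x, hx, hx0⟩ := (Matrix.exists_mulVec_eq_zero_iff
    (M := !![c₁, c₂; (potSlope f f₁ f₂ q p).1, (potSlope f f₁ f₂ q p).2])).2
    (by rw [Matrix.det_fin_two_of]; exact h0)
  have e1 : c₁ * x 0 + c₂ * x 1 = 0 := by
    simpa [Matrix.mulVec, dotProduct, Fin.sum_univ_two] using congrFun hx0 0
  have e2 : (potSlope f f₁ f₂ q p).1 * x 0 + (potSlope f f₁ f₂ q p).2 * x 1 = 0 := by
    simpa [Matrix.mulVec, dotProduct, Fin.sum_univ_two] using congrFun hx0 1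
  have hφ := F.ne
  have hq : form f q p = form f p p := F.glue p
  have hqq : form f q q = form f p p := (F.glue q).trans hq
  obtain ⟨z, hz⟩ : ∃ z, z = x 0 * (form f₁ p p / form f p p) + x 1 * (form f₂ p p / form f p p) :=
    ⟨_, rfl⟩
  have hz' : z * form f p p = x 0 * form f₁ p p + x 1 * form f₂ p p := by
    rw [hz]
    field_simp
  have hadd : ∀ v w, form (x 0 • f₁ + x 1 • f₂ + (-z) • f) v w =
      x 0 * form f₁ v w + x 1 * form f₂ v w - z * form f v w := by
    intro v w
    simp only [form, Fin.sum_univ_two, Matrix.add_apply, Matrix.smul_apply, smul_eq_mul]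
    ring
  have hsum : x 0 • f₁ + x 1 • f₂ + (-z) • f = 0 := by
    refine eq_zero_of_bil_eq_zero F.det_ne ?_ ?_ ?_ ?_ <;> rw [← form_eq_bil, hadd]
    · rw [hqq]
      linear_combination (x 0) * (h₁.1 + h₁.2) + (x 1) * (h₂.1 + h₂.2) +
        2 * form f p p * e1 - hz'
    · rw [hq]
      linear_combination (x 0) * h₁.2 + (x 1) * h₂.2 + form f p p * e1 - hz'
    · have hpq : form f p q = modulus f q p * form f p p := by
        rw [modulus, div_mul_cancel₀ _ hφ]
      simp only [potSlope] at e2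
      field_simp at e2
      rw [hpq]
      linear_combination e2 - modulus f q p * hz'
    · linear_combination -hz'
  have hall := Fintype.linearIndependent_iff.1 hli ![x 0, x 1, -z] (by
    simpa [Fin.sum_univ_three] using hsum)
  refine hx ?_
  ext i
  fin_cases i
  · simpa using hall 0
  · simpa using hall 1

variable {U : Opens (ℂ × ℂ)}

theorem psi_eq_bil (h : Matrix (Fin 2) (Fin 2) (holo U)) (v w : Vec) :
    psi f f₁ f₂ h v w = ((form f v w)⁻¹ • bil h v w) * expFactor U f f₁ f₂ v w := by
  simp only [psi, bil, Finset.smul_sum, smul_smul, div_eq_inv_mul]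

theorem psi_eq_zero (h : Matrix (Fin 2) (Fin 2) (holo U)) {v w : Vec} (hf : form f v w = 0) :
    psi f f₁ f₂ h v w = 0 := by
  rw [psi_eq_bil, hf, inv_zero, zero_smul, zero_mul]

theorem psi_smul_left {A : ℂ} (hA : A ≠ 0) (h : Matrix (Fin 2) (Fin 2) (holo U)) (v w : Vec) :
    psi f f₁ f₂ h (A • v) w = psi f f₁ f₂ h v w := by
  have h1 : bil h (A • v) w = A • bil h v w := by
    simp only [bil, Finset.smul_sum, smul_smul, Pi.smul_apply, smul_eq_mul, mul_assoc]
  have h2 : expFactor U f f₁ f₂ (A • v) w = expFactor U f f₁ f₂ v w := by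
    change expo U (form f₁ (A • v) w / form f (A • v) w, form f₂ (A • v) w / form f (A • v) w) =
      expo U (form f₁ v w / form f v w, form f₂ v w / form f v w)
    simp only [form_smul_left, mul_div_mul_left _ _ hA]
  rw [psi_eq_bil, psi_eq_bil, h1, h2, form_smul_left, smul_smul, mul_inv, mul_right_comm,
    inv_mul_cancel₀ hA, one_mul]

/-- The gluing condition of the numerator of a Baker-Akhiezer function, in terms of its values at
the two points. -/
def IsBAAt (q p : Vec) (c : ℂ × ℂ) (Lam : ℂ) (h : Matrix (Fin 2) (Fin 2) (holo U)) : Prop :=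
  bil h q q = mult U c Lam * bil h q p ∧ bil h q p = mult U c Lam * bil h p p

/-- The coordinates of the functions `ψ` with respect to `eta` and `u`. -/
def coordMat (f : Matrix (Fin 2) (Fin 2) ℂ) (q p : Vec)
    (h : Fin 2 → Matrix (Fin 2) (Fin 2) (holo U)) : Matrix (Fin 2) (Fin 2) (holo U) :=
  Matrix.of fun k => ![(form f p p)⁻¹ • bil (h k) p p, (form f p p)⁻¹ • bil (h k) p q]

theorem Frame.psi_eq (F : Frame f q p) (h₁ : IsPotAt f q p f₁ c₁) (h₂ : IsPotAt f q p f₂ c₂)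
    {h : Fin 2 → Matrix (Fin 2) (Fin 2) (holo U)} (hh : ∀ k, IsBAAt q p (c₁, c₂) Lam (h k))
    {v w : Vec} (hf : form f v w ≠ 0) :
    (fun k => psi f f₁ f₂ (h k) v w) = basisFun (potConst f f₁ f₂ p) (c₁, c₂)
      (potSlope f f₁ f₂ q p) Lam (coordMat f q p h) (F.toSurf v w hf) := by
  funext k
  rw [psi_eq_bil, F.expFactor_eq U h₁ h₂ hf, F.bil_eq hf, basisFun, (hh k).1, (hh k).2, eta]
  congr 1
  simp only [coordMat, Matrix.of_apply, Matrix.cons_val_zero, Matrix.cons_val_one, Algebra.smul_def]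
  ring

theorem Frame.toSurf_glue (F : Frame f q p) {t : Vec} (h : form f q t ≠ 0)
    (h' : form f t p ≠ 0) :
    ∃ τ, F.toSurf q t h = lineA _ τ ∧ F.toSurf t p h' = lineB _ τ := by
  have f1 : fstCoord q p q = 1 := by simpa using fstCoord_comb F.det_ne 1 0
  have f2 : fstCoord q p p = 0 := by simpa using fstCoord_comb F.det_ne 0 1
  have s1 : sndCoord q p q = 0 := by simpa using sndCoord_comb F.det_ne 1 0
  have s2 : sndCoord q p p = 1 := by simpa using sndCoord_comb F.det_ne 0 1
  have h3 := F.form_comb (fstCoord q p t) (sndCoord q p t) 0 1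
  rw [← eq_coord F.det_ne] at h3
  simp only [zero_smul, one_smul, zero_add, mul_zero, mul_one] at h3
  refine ⟨form f p p * fstCoord q p t / form f t p, Surf.ext_coord ?_ ?_ ?_,
    Surf.ext_coord ?_ ?_ ?_⟩ <;>
    simp only [Frame.toSurf, lineA, lineB, cU_of, cM_of, cR_of, f1, f2, s1, s2, F.glue]
  · simp
  · field_simp
    rw [h3]
    ring
  · simp
  · simp
  · simp
  · simp

theorem Frame.isBAAt (F : Frame f q p) (h₁ : IsPotAt f q p f₁ c₁) (h₂ : IsPotAt f q p f₂ c₂)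
    {A : ℂ} (hA : A ≠ 0) {h : Matrix (Fin 2) (Fin 2) (holo U)}
    (hh : IsBAFunction (A • q) p f f₁ f₂ Lam h) : IsBAAt q p (c₁, c₂) Lam h := by
  have key : ∀ t, form f t p ≠ 0 → bil h q t = mult U (c₁, c₂) Lam * bil h t p := by
    intro t ht
    have ht' : form f q t ≠ 0 := by rwa [F.glue]
    have e := hh t (by rw [form_smul_left]; exact mul_ne_zero hA ht')
    obtain ⟨τ, hτA, hτB⟩ := F.toSurf_glue ht' ht
    rw [psi_smul_left hA, psi_eq_bil, psi_eq_bil, F.expFactor_eq U h₁ h₂ ht',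
      F.expFactor_eq U h₁ h₂ ht, hτA, hτB, ← mul_smul_comm, ← mult_mul_waveAt_lineA, F.glue,
      smul_mul_assoc, smul_mul_assoc] at e
    have e' := smul_right_injective _ (inv_ne_zero ht) e
    refine (isUnit_expo _).mul_right_cancel (e'.trans ?_)
    rw [waveAt, wave]
    ring
  have hq : form f q p = form f p p := F.glue p
  exact ⟨key q (hq ▸ F.ne), key p F.ne⟩

theorem Frame.isBAFunction (F : Frame f q p) (h₁ : IsPotAt f q p f₁ c₁)
    (h₂ : IsPotAt f q p f₂ c₂) {A : ℂ} (hA : A ≠ 0)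
    {h : Fin 2 → Matrix (Fin 2) (Fin 2) (holo U)} (hh : ∀ k, IsBAAt q p (c₁, c₂) Lam (h k))
    (k : Fin 2) : IsBAFunction (A • q) p f f₁ f₂ Lam (h k) := by
  intro t ht
  rw [form_smul_left] at ht
  have ht1 := right_ne_zero_of_mul ht
  have ht2 : form f t p ≠ 0 := by rwa [← F.glue]
  obtain ⟨τ, hτA, hτB⟩ := F.toSurf_glue ht1 ht2
  rw [psi_smul_left hA]
  have e1 := congrFun (F.psi_eq h₁ h₂ hh ht1) k
  have e2 := congrFun (F.psi_eq h₁ h₂ hh ht2) k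
  rw [hτA, basisFun_lineA] at e1
  rw [hτB] at e2
  exact e1.trans (congrArg (fun y => Lam • y) e2.symm)

/-- The values at `(p, p)` and `(p, q)` of an admissible numerator are free and determine the rest;
unit vectors give the basis `η e`, `u e` itself. -/
theorem Frame.exists_numerators (F : Frame f q p) (c : ℂ × ℂ) (Lam : ℂ) :
    ∃ h : Fin 2 → Matrix (Fin 2) (Fin 2) (holo U), (∀ k, IsBAAt q p c Lam (h k)) ∧
      coordMat f q p h = 1 := by
  obtain ⟨B, hB1, hB2, hB3, hB4⟩ := exists_bil_eq F.det_ne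
    (form f p p • (mult U c Lam * (mult U c Lam * 1))) (form f p p • (mult U c Lam * 1))
    0 (form f p p • 1)
  obtain ⟨B', hB1', hB2', hB3', hB4'⟩ := exists_bil_eq F.det_ne (0 : holo U) 0
    (form f p p • 1) 0
  refine ⟨![B, B'], ?_, ?_⟩
  · intro k
    fin_cases k
    · exact ⟨by simp [hB1, hB2], by simp [hB2, hB4]⟩
    · exact ⟨by simp [hB1', hB2'], by simp [hB2', hB4']⟩
  · ext1 i j
    have := F.ne
    fin_cases i <;> fin_cases j <;> simp [coordMat, hB3, hB4, hB3', hB4', smul_smul, this]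

/-- At a fixed `(x, y)` the functions `η` and `u` of the point are independent and the exponential
never vanishes, so independence of `ψ₁, ψ₂` is that of the rows of the coordinate matrix. -/
theorem Frame.indepAt_iff (F : Frame f q p) (h₁ : IsPotAt f q p f₁ c₁) (h₂ : IsPotAt f q p f₂ c₂)
    {h : Fin 2 → Matrix (Fin 2) (Fin 2) (holo U)} (hh : ∀ k, IsBAAt q p (c₁, c₂) Lam (h k))
    (z : U) : IndepAt f f₁ f₂ h z ↔ holo.ev z (coordMat f q p h).det ≠ 0 := by
  obtain ⟨H, hH⟩ : ∃ H, H = coordMat f q p h := ⟨_, rfl⟩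
  have hpsi : ∀ {v w : Vec} (hf : form f v w ≠ 0) k, (psi f f₁ f₂ (h k) v w).1 z =
      (holo.ev z (H k 0) * holo.ev z (eta U (c₁, c₂) Lam (F.toSurf v w hf)) +
        cU (F.toSurf v w hf) * holo.ev z (H k 1)) * holo.ev z (waveAt U (potConst f f₁ f₂ p)
        (c₁, c₂) (potSlope f f₁ f₂ q p) (F.toSurf v w hf)) := by
    intro v w hf k
    have := congrArg (holo.ev z) (congrFun (F.psi_eq h₁ h₂ hh hf) k)
    rw [basisFun, map_mul, map_add, map_mul, map_smul, smul_eq_mul, ← hH] at this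
    exact this
  have hdet : holo.ev z (coordMat f q p h).det = ((holo.ev z).toRingHom.mapMatrix H).det := by
    rw [← hH]
    exact RingHom.map_det _ _
  rw [hdet, Ne, ← Matrix.exists_vecMul_eq_zero_iff, IndepAt, Fintype.linearIndependent_iff]
  have hsum : ∀ (a : Fin 2 → ℂ) j, Matrix.vecMul a ((holo.ev z).toRingHom.mapMatrix H) j =
      a 0 * holo.ev z (H 0 j) + a 1 * holo.ev z (H 1 j) := by
    intro a j
    simp [Matrix.vecMul, dotProduct, Fin.sum_univ_two]
  constructor
  · rintro hli ⟨a, ha, ha0⟩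
    refine ha (funext (hli a ?_))
    funext v w
    simp only [Fin.sum_univ_two, Pi.add_apply, Pi.smul_apply, Pi.zero_apply, smul_eq_mul]
    -- Where `f` vanishes, division by zero makes `psi` equal to `0`, so these arguments impose no
    -- condition.
    by_cases hf : form f v w = 0
    · rw [psi_eq_zero _ hf, psi_eq_zero _ hf]
      exact (by simp : a 0 * (0 : ℂ) + a 1 * 0 = 0)
    · rw [hpsi hf, hpsi hf]
      have e0 := (hsum a 0).symm.trans (congrFun ha0 0)
      have e1 := (hsum a 1).symm.trans (congrFun ha0 1)
      simp only [Pi.zero_apply] at e0 e1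
      linear_combination (holo.ev z (eta U (c₁, c₂) Lam (F.toSurf v w hf)) * holo.ev z (waveAt U
        (potConst f f₁ f₂ p) (c₁, c₂) (potSlope f f₁ f₂ q p) (F.toSurf v w hf))) * e0 +
        (cU (F.toSurf v w hf) * holo.ev z (waveAt U
        (potConst f f₁ f₂ p) (c₁, c₂) (potSlope f f₁ f₂ q p) (F.toSurf v w hf))) * e1
  · intro hne a ha
    by_contra hcon
    push Not at hcon
    refine hne ⟨a, fun h0 => ?_, ?_⟩
    · obtain ⟨i, hi⟩ := hcon
      exact hi (congrFun h0 i)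
    have hv : ∀ {v w : Vec} (hf : form f v w ≠ 0),
        (a 0 * holo.ev z (H 0 0) + a 1 * holo.ev z (H 1 0)) *
          holo.ev z (eta U (c₁, c₂) Lam (F.toSurf v w hf)) +
        (a 0 * holo.ev z (H 0 1) + a 1 * holo.ev z (H 1 1)) * cU (F.toSurf v w hf) = 0 := by
      intro v w hf
      have e := congrFun (congrFun ha v) w
      simp only [Fin.sum_univ_two, Pi.add_apply, Pi.smul_apply, Pi.zero_apply, smul_eq_mul] at e
      rw [hpsi hf, hpsi hf] at e
      have hne : holo.ev z (waveAt U (potConst f f₁ f₂ p) (c₁, c₂) (potSlope f f₁ f₂ q p)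
          (F.toSurf v w hf)) ≠ 0 := Complex.exp_ne_zero _
      refine (mul_eq_zero.1 (Eq.trans ?_ e)).resolve_right hne
      ring
    -- Two test points: `(u, m, r) = (0, 0, 0)`, where `η = 1` and `u = 0`, and `(1, 0, 0)`, where
    -- `u = 1`.
    obtain ⟨hf1, hx1⟩ := F.toSurf_lineB 0
    have hr2 : (0 : ℂ) ^ 2 = 0 * (0 + (modulus f q p - 2) * 1 - 1) + 1 * 0 := by ring
    obtain ⟨hf2, hx2⟩ := F.exists_toSurf_of_comb (a := 0) (b := 1) (a' := 1)
      (b' := 1 - modulus f q p) (x := .of 1 0 0 hr2) (by ring) (by simp) (by simp) (by simp)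
    have e1 := hv hf1
    have e2 := hv hf2
    rw [hx1] at e1
    rw [hx2] at e2
    have e0 : a 0 * holo.ev z (H 0 0) + a 1 * holo.ev z (H 1 0) = 0 := by
      simpa [lineB, eta] using e1
    rw [e0, zero_mul, zero_add, cU_of, mul_one] at e2
    funext j
    fin_cases j
    · exact (hsum a 0).trans e0
    · exact (hsum a 1).trans e2

/-- A zero determinant makes the columns of the adjugate give relations between the rows;
independence kills them, so the matrix vanishes and then every combination is a relation. No
division is needed. -/
theorem Frame.det_coordMat_ne_zero (F : Frame f q p) (hU : (U : Set (ℂ × ℂ)).Nonempty)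
    (h₁ : IsPotAt f q p f₁ c₁) (h₂ : IsPotAt f q p f₂ c₂)
    {h : Fin 2 → Matrix (Fin 2) (Fin 2) (holo U)} (hh : ∀ k, IsBAAt q p (c₁, c₂) Lam (h k))
    (hli : LinearIndependent (holo U) fun k => psi f f₁ f₂ (h k)) :
    (coordMat f q p h).det ≠ 0 := by
  obtain ⟨z, hz⟩ := hU
  have hnt : Nontrivial (holo U) := ⟨0, 1, fun h01 => by
    simpa using congrArg (holo.ev ⟨z, hz⟩) h01⟩
  obtain ⟨H, hH⟩ : ∃ H, H = coordMat f q p h := ⟨_, rfl⟩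
  rw [← hH]
  intro hdet
  rw [Matrix.det_fin_two] at hdet
  have hpsi : ∀ {v w : Vec} (hf : form f v w ≠ 0) k, psi f f₁ f₂ (h k) v w =
      (H k 0 * eta U (c₁, c₂) Lam (F.toSurf v w hf) + cU (F.toSurf v w hf) • H k 1) *
        waveAt U (potConst f f₁ f₂ p) (c₁, c₂) (potSlope f f₁ f₂ q p) (F.toSurf v w hf) :=
    fun hf k => (congrFun (F.psi_eq h₁ h₂ hh hf) k).trans (by rw [basisFun, ← hH])
  have key : ∀ a : Fin 2 → holo U, (∀ j, a 0 * H 0 j + a 1 * H 1 j = 0) → ∀ i, a i = 0 := by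
    intro a ha
    refine Fintype.linearIndependent_iff.1 hli a ?_
    funext v w
    simp only [Fin.sum_univ_two, Pi.add_apply, Pi.smul_apply, Pi.zero_apply, smul_eq_mul]
    by_cases hf : form f v w = 0
    · rw [psi_eq_zero _ hf, psi_eq_zero _ hf, mul_zero, mul_zero, add_zero]
    · rw [hpsi hf, hpsi hf]
      simp only [Algebra.smul_def]
      linear_combination (eta U (c₁, c₂) Lam (F.toSurf v w hf) * waveAt U
        (potConst f f₁ f₂ p) (c₁, c₂) (potSlope f f₁ f₂ q p) (F.toSurf v w hf)) * ha 0 +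
        (algebraMap ℂ (holo U) (cU (F.toSurf v w hf)) * waveAt U
        (potConst f f₁ f₂ p) (c₁, c₂) (potSlope f f₁ f₂ q p) (F.toSurf v w hf)) * ha 1
  have k0 := key ![H 1 0, -H 0 0] (by
    intro j
    fin_cases j
    · simp
      ring
    · simp
      linear_combination -hdet)
  have k1 := key ![H 1 1, -H 0 1] (by
    intro j
    fin_cases j
    · simp
      linear_combination hdet
    · simp
      ring)
  have z10 : H 1 0 = 0 := k0 0
  have z00 : H 0 0 = 0 := neg_eq_zero.1 (k0 1)
  have z11 : H 1 1 = 0 := k1 0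
  have z01 : H 0 1 = 0 := neg_eq_zero.1 (k1 1)
  have := key 1 (by
    intro j
    fin_cases j <;> simp [z00, z01, z10, z11]) 0
  exact one_ne_zero this

end FramePsi

/-! ### Meromorphic functions as regular functions on the surface -/

section Curve

theorem dense_analytic_ne_zero {Φ : Vec × Vec → ℂ} (hΦ : AnalyticOnNhd ℂ Φ Set.univ)
    (h0 : ∃ x, Φ x ≠ 0) : Dense {x | Φ x ≠ 0} := by
  refine dense_iff_inter_open.2 fun O hO hne => ?_
  by_contra hemp
  obtain ⟨z, hz⟩ := hne
  have hev : Φ =ᶠ[nhds z] 0 := by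
    filter_upwards [hO.mem_nhds hz] with x hx
    by_contra hx0
    exact hemp ⟨x, hx, hx0⟩
  obtain ⟨x, hx⟩ := h0
  exact hx (AnalyticOnNhd.eqOn_zero_of_preconnected_of_eventuallyEq_zero hΦ
    isPreconnected_univ (Set.mem_univ z) hev (Set.mem_univ x))

theorem eq_of_dense_of_continuousAt {X : Type*} [TopologicalSpace X] {Φ Ψ : X → ℂ} {S : Set X}
    (hS : Dense S) {x : X} (hΦ : ContinuousAt Φ x) (hΨ : ContinuousAt Ψ x)
    (h : ∀ y ∈ S, Φ y = Ψ y) : Φ x = Ψ x := by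
  have : (nhdsWithin x S).NeBot := mem_closure_iff_nhdsWithin_neBot.1 (hS x)
  refine tendsto_nhds_unique
    (hΦ.mono_left nhdsWithin_le_nhds : Filter.Tendsto Φ (nhdsWithin x S) _) ?_
  refine (hΨ.mono_left nhdsWithin_le_nhds).congr' ?_
  filter_upwards [self_mem_nhdsWithin] with y hy using (h y hy).symm

variable {f : Matrix (Fin 2) (Fin 2) ℂ} {q p : Vec}

theorem form_zero_left (w : Vec) : form f 0 w = 0 := by simp [form]

theorem form_zero_right (v : Vec) : form f v 0 = 0 := by simp [form]

theorem ne_zero_of_form {v w : Vec} (h : form f v w ≠ 0) : v ≠ 0 ∧ w ≠ 0 :=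
  ⟨fun h0 => h (h0 ▸ form_zero_left w), fun h0 => h (h0 ▸ form_zero_right v)⟩

theorem form_rep_eq_zero_iff {v w : Vec} (hv : v ≠ 0) (hw : w ≠ 0) :
    form f (Projectivization.mk ℂ v hv).rep (Projectivization.mk ℂ w hw).rep = 0 ↔
      form f v w = 0 := by
  obtain ⟨a, ha⟩ := Projectivization.exists_smul_eq_mk_rep ℂ v hv
  obtain ⟨b, hb⟩ := Projectivization.exists_smul_eq_mk_rep ℂ w hw
  rw [← ha, ← hb, Units.smul_def, Units.smul_def, form_smul_left, form_smul_right, mul_eq_zero,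
    mul_eq_zero, or_iff_right a.ne_zero, or_iff_right b.ne_zero]

/-- A point of `Γ` on the double line has several representatives; `f(q, t) = f(t, p)` makes the
vanishing of `f` independent of the choice, so it descends to the quotient. -/
theorem Frame.notMem_curve_iff (F : Frame f q p) {hq : q ≠ 0} {hp : p ≠ 0} {v w : Vec}
    (hv : v ≠ 0) (hw : w ≠ 0) :
    pt (Projectivization.mk ℂ q hq) (Projectivization.mk ℂ p hp) v w hv hw ∉
      curve (Projectivization.mk ℂ q hq) (Projectivization.mk ℂ p hp) f ↔ form f v w ≠ 0 := by
  refine not_congr ⟨?_, fun h => ⟨v, w, hv, hw, h, rfl⟩⟩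
  rintro ⟨v', w', hv', hw', h', heq⟩
  have hresp : ∀ x y, Glue (Projectivization.mk ℂ q hq) (Projectivization.mk ℂ p hp) x y →
      (form f x.1.rep x.2.rep = 0) = (form f y.1.rep y.2.rep = 0) := by
    rintro _ _ ⟨t⟩
    obtain ⟨t, ht, rfl⟩ : ∃ (t' : Vec) (ht : t' ≠ 0), t = Projectivization.mk ℂ t' ht :=
      ⟨t.rep, t.rep_nonzero, t.mk_rep.symm⟩
    simp only [form_rep_eq_zero_iff, F.glue]
  have := congrArg (Quot.lift (fun x : PLine × PLine => form f x.1.rep x.2.rep = 0) hresp) heq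
  change (form f (Projectivization.mk ℂ v hv).rep (Projectivization.mk ℂ w hw).rep = 0) =
    (form f (Projectivization.mk ℂ v' hv').rep (Projectivization.mk ℂ w' hw').rep = 0) at this
  rw [form_rep_eq_zero_iff, form_rep_eq_zero_iff] at this
  exact this.mpr h'

theorem pt_smul_left {P₁ P₂ : PLine} {a : ℂ} (ha : a ≠ 0) {v w : Vec} (hv : v ≠ 0) (hw : w ≠ 0) :
    pt P₁ P₂ (a • v) w (smul_ne_zero ha hv) hw = pt P₁ P₂ v w hv hw := by
  unfold pt
  rw [(Projectivization.mk_eq_mk_iff' ℂ (a • v) v (smul_ne_zero ha hv) hv).2 ⟨a, rfl⟩]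

theorem pt_smul_right {P₁ P₂ : PLine} {a : ℂ} (ha : a ≠ 0) {v w : Vec} (hv : v ≠ 0) (hw : w ≠ 0) :
    pt P₁ P₂ v (a • w) hv (smul_ne_zero ha hw) = pt P₁ P₂ v w hv hw := by
  unfold pt
  rw [(Projectivization.mk_eq_mk_iff' ℂ (a • w) w (smul_ne_zero ha hw) hw).2 ⟨a, rfl⟩]

theorem analyticOnNhd_form (f : Matrix (Fin 2) (Fin 2) ℂ) (s : Set (Vec × Vec)) :
    AnalyticOnNhd ℂ (fun q : Vec × Vec => form f q.1 q.2) s := by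
  simpa using analyticOnNhd_form_pow f 1 s

/-- `lam * f ^ N` is bihomogeneous of degree `N` in each variable off the curve, hence by density
everywhere, hence a polynomial; each `v i * w j / f` is regular on the surface. -/
theorem Frame.exists_regFun (F : Frame f q p) {hq : q ≠ 0} {hp : p ≠ 0}
    (lam : meroRing (Projectivization.mk ℂ q hq) (Projectivization.mk ℂ p hp) f) :
    ∃ n ∈ regFun (modulus f q p), ∀ (v w : Vec) (hv : v ≠ 0) (hw : w ≠ 0)
      (hP : pt (Projectivization.mk ℂ q hq) (Projectivization.mk ℂ p hp) v w hv hw ∉ curve _ _ f)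
      (hf : form f v w ≠ 0), lam.1 ⟨_, hP⟩ = n (F.toSurf v w hf) := by
  obtain ⟨lam, N, G, hG, hlam⟩ := lam
  have hdense : Dense {x : Vec × Vec | form f x.1 x.2 ≠ 0} :=
    dense_analytic_ne_zero (analyticOnNhd_form f _) ⟨(p, p), F.ne⟩
  have hG1 : ∀ v w, v ≠ 0 → w ≠ 0 → ∀ a : ℂ, a ≠ 0 → G (a • v, w) = a ^ N * G (v, w) := by
    intro v w hv hw a ha
    refine eq_of_dense_of_continuousAt (Φ := fun x : Vec × Vec => G (a • x.1, x.2))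
      (Ψ := fun x => a ^ N * G x) hdense (x := (v, w)) ?_ ?_ ?_
    · exact ContinuousAt.comp (g := G) (f := fun x : Vec × Vec => (a • x.1, x.2))
        (hG _ ⟨smul_ne_zero ha hv, hw⟩).continuousAt (by fun_prop)
    · exact continuousAt_const.mul (hG _ ⟨hv, hw⟩).continuousAt
    · rintro ⟨v, w⟩ hf
      obtain ⟨hv, hw⟩ := ne_zero_of_form hf
      have hP := (F.notMem_curve_iff (hq := hq) (hp := hp) hv hw).2 hf
      have e1 := hlam v w hv hw hP
      have e2 := hlam (a • v) w (smul_ne_zero ha hv) hw (by rwa [pt_smul_left ha hv hw])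
      simp only [pt_smul_left ha hv hw] at e2
      change G (a • v, w) = a ^ N * G (v, w)
      rw [← e1, ← e2, form_smul_left]
      ring
  have hG2 : ∀ v w, v ≠ 0 → w ≠ 0 → ∀ a : ℂ, a ≠ 0 → G (v, a • w) = a ^ N * G (v, w) := by
    intro v w hv hw a ha
    refine eq_of_dense_of_continuousAt (Φ := fun x : Vec × Vec => G (x.1, a • x.2))
      (Ψ := fun x => a ^ N * G x) hdense (x := (v, w)) ?_ ?_ ?_
    · exact ContinuousAt.comp (g := G) (f := fun x : Vec × Vec => (x.1, a • x.2))
        (hG _ ⟨hv, smul_ne_zero ha hw⟩).continuousAt (by fun_prop)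
    · exact continuousAt_const.mul (hG _ ⟨hv, hw⟩).continuousAt
    · rintro ⟨v, w⟩ hf
      obtain ⟨hv, hw⟩ := ne_zero_of_form hf
      have hP := (F.notMem_curve_iff (hq := hq) (hp := hp) hv hw).2 hf
      have e1 := hlam v w hv hw hP
      have e2 := hlam v (a • w) hv (smul_ne_zero ha hw) (by rwa [pt_smul_right ha hv hw])
      simp only [pt_smul_right ha hv hw] at e2
      change G (v, a • w) = a ^ N * G (v, w)
      rw [← e1, ← e2, form_smul_right]
      ring
  obtain ⟨a, ha⟩ := exists_bihomogeneous_sum N hG hG1 hG2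
  let l : Fin 2 → Fin 2 → Surf (modulus f q p) → ℂ := fun i j => (form f p p)⁻¹ •
    ((q i * q j) • cR + (q i * p j) • (cM - (2 : ℂ) • cR) + (p i * q j) • cU +
      (p i * p j) • (1 - cM + cR - modulus f q p • cU))
  have hl : ∀ i j, l i j ∈ regFun (modulus f q p) := fun i j =>
    (regFun _).smul_mem (add_mem (add_mem (add_mem ((regFun _).smul_mem cR_mem _)
      ((regFun _).smul_mem (sub_mem cM_mem ((regFun _).smul_mem cR_mem 2)) _))
      ((regFun _).smul_mem cU_mem _)) ((regFun _).smul_mem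
      (sub_mem (add_mem (sub_mem (one_mem _) cM_mem) cR_mem) ((regFun _).smul_mem cU_mem _)) _)) _
  have hlv : ∀ (i j : Fin 2) (v w : Vec) (hf : form f v w ≠ 0),
      l i j (F.toSurf v w hf) = v i * w j / form f v w := by
    intro i j v w hf
    have hs : ∀ v w : Vec, bil (Matrix.single i j (1 : ℂ)) v w = v i * w j := by
      intro v w
      fin_cases i <;> fin_cases j <;> simp [bil, Fin.sum_univ_two]
    have := F.bil_eq hf (Matrix.single i j (1 : ℂ))
    simp only [hs, smul_eq_mul] at this
    rw [div_eq_inv_mul, this]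
    simp only [l, Pi.smul_apply, Pi.add_apply, Pi.sub_apply, Pi.one_apply, smul_eq_mul]
    ring
  -- The `k`-th factor uses the coordinate of index `0` for `k < i` and of index `1` afterwards,
  -- likewise for `j`; each of the `N` factors absorbs one `f`.
  refine ⟨∑ i, ∑ j, a i j • ∏ k ∈ Finset.range N, l (if k < (i : ℕ) then 0 else 1)
    (if k < (j : ℕ) then 0 else 1), ?_, ?_⟩
  · exact sum_mem fun i _ => sum_mem fun j _ => (regFun _).smul_mem (prod_mem fun k _ => hl _ _) _
  · intro v w hv hw hP hf
    have e := hlam v w hv hw hP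
    rw [ha v w hv hw] at e
    change lam ⟨_, hP⟩ = _
    rw [eq_div_of_mul_eq (pow_ne_zero N hf) e]
    simp only [Finset.sum_apply, Pi.smul_apply, Finset.prod_apply, hlv, Finset.prod_div_distrib,
      Finset.prod_mul_distrib, Finset.prod_const, Finset.card_range, Finset.sum_div, smul_eq_mul,
      apply_ite v, apply_ite w, prod_range_ite _ _ (Nat.le_of_lt_succ (Fin.is_lt _)), mul_div_assoc]

theorem Frame.regFun_glue (F : Frame f q p) {hq : q ≠ 0} {hp : p ≠ 0}
    (lam : meroRing (Projectivization.mk ℂ q hq) (Projectivization.mk ℂ p hp) f)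
    {n : Surf (modulus f q p) → ℂ} (hn : ∀ (v w : Vec) (hv : v ≠ 0) (hw : w ≠ 0)
      (hP : pt (Projectivization.mk ℂ q hq) (Projectivization.mk ℂ p hp) v w hv hw ∉ curve _ _ f)
      (hf : form f v w ≠ 0), lam.1 ⟨_, hP⟩ = n (F.toSurf v w hf)) (τ : ℂ) :
    n (lineA _ τ) = n (lineB _ τ) := by
  obtain ⟨hA, hA'⟩ := F.toSurf_lineA τ
  obtain ⟨hB, hB'⟩ := F.toSurf_lineB τ
  have ht := (ne_zero_of_form hA).2
  have hP := (F.notMem_curve_iff (hq := hq) (hp := hp) hq ht).2 hA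
  have hP' := (F.notMem_curve_iff (hq := hq) (hp := hp) ht hp).2 hB
  rw [← hA', ← hB', ← hn _ _ hq ht hP, ← hn _ _ ht hp hP']
  exact congrArg lam.1 (Subtype.ext (Quot.sound (Glue.glue _)))

end Curve

/-! ### The action of matrix operators on columns -/

section Act

variable {W : Opens (ℂ × ℂ)}

theorem act_one (g : Fin 2 → holo W) : act (1 : Matrix (Fin 2) (Fin 2) (diffOp W)) g = g := by
  funext i
  rw [act, Finset.sum_eq_single i (fun j _ hj => by rw [Matrix.one_apply_ne hj.symm]; rfl)
    (by simp), Matrix.one_apply_eq]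
  rfl

theorem act_mul (B B' : Matrix (Fin 2) (Fin 2) (diffOp W)) (g : Fin 2 → holo W) :
    act (B * B') g = act B (act B' g) := by
  funext i
  simp only [act, Matrix.mul_apply, Fin.sum_univ_two, Subalgebra.coe_add, Subalgebra.coe_mul,
    LinearMap.add_apply, Module.End.mul_apply, map_add]
  abel

theorem act_add (B B' : Matrix (Fin 2) (Fin 2) (diffOp W)) (g : Fin 2 → holo W) :
    act (B + B') g = act B g + act B' g := by
  funext i
  simp only [act, Matrix.add_apply, Subalgebra.coe_add, LinearMap.add_apply, Pi.add_apply,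
    Finset.sum_add_distrib]

theorem act_zero (g : Fin 2 → holo W) : act (0 : Matrix (Fin 2) (Fin 2) (diffOp W)) g = 0 := by
  funext i
  simp [act]

theorem act_smul (B : Matrix (Fin 2) (Fin 2) (diffOp W)) (z : ℂ) (g : Fin 2 → holo W) :
    act B (z • g) = z • act B g := by
  funext i
  simp only [act, Pi.smul_apply, map_smul, Finset.smul_sum]

end Act

/-! ### The ring homomorphism -/

section Main

variable {f f₁ f₂ : Matrix (Fin 2) (Fin 2) ℂ} {q p : Vec} {c₁ c₂ Lam : ℂ} {W : Opens (ℂ × ℂ)}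

/-- Since `lam` does not depend on `(x, y)`, it commutes with operators; products and sums of the
`D(lam)` solve the eigenvalue equations of products and sums, and uniqueness identifies them. -/
theorem Frame.exists_ringHom (F : Frame f q p) {hq : q ≠ 0} {hp : p ≠ 0}
    (h₁ : IsPotAt f q p f₁ c₁) (h₂ : IsPotAt f q p f₂ c₂)
    (hli : LinearIndependent ℂ ![f₁, f₂, f]) (hW : (W : Set (ℂ × ℂ)).Nonempty)
    {h : Fin 2 → Matrix (Fin 2) (Fin 2) (holo W)} (hh : ∀ k, IsBAAt q p (c₁, c₂) Lam (h k))
    (hH : IsUnit (coordMat f q p h)) (hε : IsUnit (mult W (c₁, c₂) Lam - 1)) :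
    ∃ D : meroRing (Projectivization.mk ℂ q hq) (Projectivization.mk ℂ p hp) f →+*
        Matrix (Fin 2) (Fin 2) (diffOp W),
      Function.Injective D ∧ (∀ lam, IsEigen _ _ f f₁ f₂ h lam (D lam)) ∧
      (∀ lam (B : Matrix (Fin 2) (Fin 2) (diffOp W)),
        IsEigen _ _ f f₁ f₂ h lam B → B = D lam) ∧
      ∀ lam mu, Commute (D lam) (D mu) := by
  have hΔ := F.discr_ne_zero h₁ h₂ hli
  have hpsi : ∀ {v w : Vec} (hf : form f v w ≠ 0), (fun k => psi f f₁ f₂ (h k) v w) = _ :=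
    fun hf => F.psi_eq h₁ h₂ hh hf
  have hex : ∀ lam : meroRing (Projectivization.mk ℂ q hq) (Projectivization.mk ℂ p hp) f,
      ∃ B, IsEigen _ _ f f₁ f₂ h lam B := by
    intro lam
    obtain ⟨n, hn, hlam⟩ := F.exists_regFun lam
    obtain ⟨B, hB⟩ := exists_matrix_act (β := potConst f f₁ f₂ p) hΔ hε hH
      (fun τ => basisFun_lineA _ τ) hn (F.regFun_glue lam hlam)
    refine ⟨B, fun v w hv hw hP => ?_⟩
    have hf := (F.notMem_curve_iff hv hw).1 hP
    rw [hpsi hf, hB, hlam v w hv hw hP hf]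
  have huniq : ∀ (lam : meroRing (Projectivization.mk ℂ q hq) (Projectivization.mk ℂ p hp) f) B B',
      IsEigen _ _ f f₁ f₂ h lam B → IsEigen _ _ f f₁ f₂ h lam B' → B = B' := by
    intro lam B B' hB hB'
    refine matrix_eq_of_act_eq (β := potConst f f₁ f₂ p) (κ := modulus f q p) hΔ hε hH B B'
      fun x hx => ?_
    obtain ⟨v, w, hf, rfl⟩ := F.exists_toSurf hx
    obtain ⟨hv, hw⟩ := ne_zero_of_form hf
    have hP := (F.notMem_curve_iff (hq := hq) (hp := hp) hv hw).2 hf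
    rw [← hpsi hf]
    exact (hB v w hv hw hP).trans (hB' v w hv hw hP).symm
  choose D hD using hex
  have hone : D 1 = 1 := huniq 1 _ _ (hD 1) fun v w hv hw hP => by
    rw [act_one]
    exact (one_smul ℂ _).symm
  have hzero : D 0 = 0 := huniq 0 _ _ (hD 0) fun v w hv hw hP => by
    rw [act_zero]
    exact (zero_smul ℂ _).symm
  have hmul : ∀ a b, D (a * b) = D a * D b := fun a b =>
    huniq (a * b) _ _ (hD _) fun v w hv hw hP => by
      rw [act_mul, hD b v w hv hw hP, act_smul, hD a v w hv hw hP, smul_smul, mul_comm]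
      rfl
  have hadd : ∀ a b, D (a + b) = D a + D b := fun a b =>
    huniq (a + b) _ _ (hD _) fun v w hv hw hP => by
      rw [act_add, hD b v w hv hw hP, hD a v w hv hw hP, ← add_smul]
      rfl
  refine ⟨⟨⟨⟨D, hone⟩, hmul⟩, hzero, hadd⟩, ?_, hD, fun lam B hB => huniq lam _ _ hB (hD lam), ?_⟩
  · intro lam mu hlm
    have hlm : D lam = D mu := hlm
    -- Where `u ≠ 0` the vector `ψ` is nonzero, because the coordinate matrix is invertible; equal
    -- operators then have equal eigenvalues there. Density extends this to the whole complement.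
    have hval : ∀ (v w : Vec) (hv : v ≠ 0) (hw : w ≠ 0)
        (hP : pt (Projectivization.mk ℂ q hq) (Projectivization.mk ℂ p hp) v w hv hw ∉ curve _ _ f),
        sndCoord q p v * fstCoord q p w ≠ 0 → lam.1 ⟨_, hP⟩ = mu.1 ⟨_, hP⟩ := by
      intro v w hv hw hP hu
      have hf := (F.notMem_curve_iff hv hw).1 hP
      have e := (hD lam v w hv hw hP).symm.trans (hlm ▸ hD mu v w hv hw hP)
      by_contra hne
      have hψ : (fun k => psi f f₁ f₂ (h k) v w) = 0 := by
        funext k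
        have ek := congrFun e k
        simp only [Pi.smul_apply] at ek
        rw [← sub_eq_zero, ← sub_smul] at ek
        exact (smul_eq_zero.1 ek).resolve_left (sub_ne_zero.2 hne)
      rw [hpsi hf] at hψ
      obtain ⟨K, hK⟩ := hH.exists_left_inv
      have hvec : (coordMat f q p h).mulVec
          ![eta W (c₁, c₂) Lam (F.toSurf v w hf), algebraMap ℂ _ (cU (F.toSurf v w hf))] = 0 := by
        funext k
        have := congrFun hψ k
        rw [basisFun, Pi.zero_apply] at this
        have hz := (isUnit_expo (U := W) _).mul_left_eq_zero.1 this
        rw [Algebra.smul_def, mul_comm (algebraMap _ _ _)] at hz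
        simpa [Matrix.mulVec, dotProduct, Fin.sum_univ_two] using hz
      have h0 := congrArg K.mulVec hvec
      rw [Matrix.mulVec_mulVec, hK, Matrix.one_mulVec, Matrix.mulVec_zero] at h0
      have h1 : algebraMap ℂ (holo W) (cU (F.toSurf v w hf)) = 0 := congrFun h0 1
      obtain ⟨z, hz⟩ := hW
      have h2 : cU (F.toSurf v w hf) = 0 := by
        simpa using congrArg (holo.ev ⟨z, hz⟩) h1
      rw [Frame.toSurf, cU_of] at h2
      exact div_ne_zero (mul_ne_zero F.ne hu) hf h2
    obtain ⟨N, G, hG, hlam⟩ := lam.2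
    obtain ⟨N', G', hG', hmu⟩ := mu.2
    have hcoord : AnalyticOnNhd ℂ
        (fun x : Vec × Vec => sndCoord q p x.1 * fstCoord q p x.2) Set.univ := by
      obtain ⟨B, hB1, hB2, hB3, hB4⟩ := exists_bil_eq F.det_ne (0 : ℂ) 0 1 0
      convert analyticOnNhd_form B Set.univ using 2 with x
      have := bil_expand B (fstCoord q p x.1) (sndCoord q p x.1) (fstCoord q p x.2)
        (sndCoord q p x.2) q p
      rw [← eq_coord F.det_ne, ← eq_coord F.det_ne, hB1, hB2, hB3, hB4] at this
      rw [form_eq_bil, this]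
      simp
    have hdense : Dense {x : Vec × Vec |
        form f x.1 x.2 * (sndCoord q p x.1 * fstCoord q p x.2) ≠ 0} := by
      refine dense_analytic_ne_zero ((analyticOnNhd_form f _).mul hcoord)
        -- At this point `f = f(p, p)` and `u = 1`.
        ⟨((0 : ℂ) • q + (1 : ℂ) • p, (1 : ℂ) • q + (1 - modulus f q p) • p), ?_⟩
      rw [F.form_comb, sndCoord_comb F.det_ne, fstCoord_comb F.det_ne]
      simpa using F.ne
    refine Subtype.ext (funext ?_)
    rintro ⟨⟨⟨P, Q⟩⟩, hP⟩
    obtain ⟨v, hv, rfl⟩ : ∃ (v : Vec) (hv : v ≠ 0), P = Projectivization.mk ℂ v hv :=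
      ⟨P.rep, P.rep_nonzero, P.mk_rep.symm⟩
    obtain ⟨w, hw, rfl⟩ : ∃ (w : Vec) (hw : w ≠ 0), Q = Projectivization.mk ℂ w hw :=
      ⟨Q.rep, Q.rep_nonzero, Q.mk_rep.symm⟩
    change lam.1 ⟨pt _ _ v w hv hw, hP⟩ = mu.1 ⟨pt _ _ v w hv hw, hP⟩
    have hf := (F.notMem_curve_iff hv hw).1 hP
    have key : G (v, w) * form f v w ^ N' = G' (v, w) * form f v w ^ N := by
      refine eq_of_dense_of_continuousAt
        (Φ := fun x : Vec × Vec => G x * form f x.1 x.2 ^ N')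
        (Ψ := fun x : Vec × Vec => G' x * form f x.1 x.2 ^ N) hdense (x := (v, w)) ?_ ?_ ?_
      · exact ((hG (v, w) ⟨hv, hw⟩).mul
          (analyticOnNhd_form_pow f N' Set.univ (v, w) trivial)).continuousAt
      · exact ((hG' (v, w) ⟨hv, hw⟩).mul
          (analyticOnNhd_form_pow f N Set.univ (v, w) trivial)).continuousAt
      · rintro ⟨v, w⟩ hx
        have hf := left_ne_zero_of_mul hx
        obtain ⟨hv, hw⟩ := ne_zero_of_form hf
        have hP := (F.notMem_curve_iff (hq := hq) (hp := hp) hv hw).2 hf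
        change G (v, w) * form f v w ^ N' = G' (v, w) * form f v w ^ N
        rw [← hlam v w hv hw hP, ← hmu v w hv hw hP, hval v w hv hw hP (right_ne_zero_of_mul hx)]
        ring
    rw [← hlam v w hv hw hP, ← hmu v w hv hw hP] at key
    refine mul_right_cancel₀ (mul_ne_zero (pow_ne_zero N hf) (pow_ne_zero N' hf)) ?_
    linear_combination key
  · intro lam mu
    change D lam * D mu = D mu * D lam
    rw [← hmul, ← hmul, mul_comm]

end Main

/-! ### The regular locus and restriction -/

section Regular

variable {f f₁ f₂ : Matrix (Fin 2) (Fin 2) ℂ} {q p : Vec} {c₁ c₂ Lam : ℂ} {U : Opens (ℂ × ℂ)}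

theorem mult_sub_one_ne_zero (hU : (U : Set (ℂ × ℂ)).Nonempty) {c γ : ℂ × ℂ}
    (h : c.1 * γ.2 - c.2 * γ.1 ≠ 0) : mult U c Lam - 1 ≠ 0 := by
  intro h0
  obtain ⟨z, hz⟩ := hU
  -- If `μ` were identically `1`, the same exponential would be an eigenfunction of `opM` with
  -- eigenvalues `0` and `-1`.
  have e0 := opM_wave (W := U) (β := 0) h 0 0
  have e1 := opM_mult_pow_mul_wave (W := U) (β := 0) h Lam 0 0 1
  rw [sub_eq_zero.1 h0, one_pow, one_mul, e0] at e1
  have := congrArg (holo.ev ⟨z, hz⟩) e1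
  rw [map_smul, map_smul, zero_smul] at this
  simp only [Nat.cast_one, zero_sub, smul_eq_mul, neg_mul, one_mul] at this
  exact Complex.exp_ne_zero _ (neg_eq_zero.1 this.symm)

theorem ev_mult (c : ℂ × ℂ) (z : U) :
    holo.ev z (mult U c Lam) = Lam * Complex.exp (-(c.1 * z.1.1 + c.2 * z.1.2)) := by
  rw [mult, map_smul, ev_expo, smul_eq_mul]
  congr 2
  simp only [Prod.fst_neg, Prod.snd_neg]
  ring

theorem Frame.regularLocus_eq (F : Frame f q p) (h₁ : IsPotAt f q p f₁ c₁)
    (h₂ : IsPotAt f q p f₂ c₂) {h : Fin 2 → Matrix (Fin 2) (Fin 2) (holo U)}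
    (hh : ∀ k, IsBAAt q p (c₁, c₂) Lam (h k)) :
    regularLocus f f₁ f₂ c₁ c₂ Lam h = {z | holo.ev z (mult U (c₁, c₂) Lam - 1) ≠ 0} ∩
      {z | holo.ev z (coordMat f q p h).det ≠ 0} := by
  ext z
  change _ ≠ _ ∧ _ ↔ _ ≠ _ ∧ _ ≠ _
  rw [F.indepAt_iff h₁ h₂ hh, map_sub, map_one, sub_ne_zero, ev_mult]

variable {W : Opens (ℂ × ℂ)} (hWU : W ≤ U)

theorem ev_bil_res (h : Matrix (Fin 2) (Fin 2) (holo U)) (v w : Vec) (z : W) :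
    holo.ev z (bil (h.map (holo.res hWU)) v w) = holo.ev ⟨z.1, hWU z.2⟩ (bil h v w) := by
  simp only [bil, map_sum, map_smul, Matrix.map_apply, ev_res]

theorem ev_mult_res (c : ℂ × ℂ) (z : W) :
    holo.ev z (mult W c Lam) = holo.ev ⟨z.1, hWU z.2⟩ (mult U c Lam) := by
  rw [ev_mult, ev_mult]

theorem IsBAAt.res {c : ℂ × ℂ} {h : Matrix (Fin 2) (Fin 2) (holo U)} (hh : IsBAAt q p c Lam h) :
    IsBAAt q p c Lam (h.map (holo.res hWU)) := by
  constructor <;> refine holo.ext_ev fun z => ?_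
  · rw [map_mul, ev_bil_res, ev_bil_res, ev_mult_res hWU, hh.1, map_mul]
  · rw [map_mul, ev_bil_res, ev_bil_res, ev_mult_res hWU, hh.2, map_mul]

theorem ev_det_coordMat_res (h : Fin 2 → Matrix (Fin 2) (Fin 2) (holo U)) (z : W) :
    holo.ev z (coordMat f q p fun k => (h k).map (holo.res hWU)).det =
      holo.ev ⟨z.1, hWU z.2⟩ (coordMat f q p h).det := by
  simp only [Matrix.det_fin_two, coordMat, Matrix.of_apply, Matrix.cons_val_zero,
    Matrix.cons_val_one, map_sub, map_mul, map_smul, ev_bil_res]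

end Regular

/-- Distinct points give a basis. If `f(p, p)` were zero, gluing would give `f(q, p) = 0` and then
`f(q, q) = 0`, so `f` would vanish on the whole first line. -/
theorem frame_of_gluing {q p₂ : Vec} {A : ℂ} (hA : A ≠ 0) (hp₁ : A • q ≠ 0) (hp₂ : p₂ ≠ 0)
    (hp : Projectivization.mk ℂ (A • q) hp₁ ≠ Projectivization.mk ℂ p₂ hp₂)
    {f : Matrix (Fin 2) (Fin 2) ℂ} (hf : ∀ t, form f (A • q) t - A * form f t p₂ = 0)
    (hf0 : ∃ t, form f (A • q) t ≠ 0) : Frame f q p₂ := by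
  have hglue : ∀ t, form f q t = form f t p₂ := fun t => by
    have := hf t
    rw [form_smul_left, ← mul_sub] at this
    exact sub_eq_zero.1 ((mul_eq_zero.1 this).resolve_left hA)
  have hdet : q 0 * p₂ 1 - q 1 * p₂ 0 ≠ 0 := by
    intro h0
    refine hp ((Projectivization.mk_eq_mk_iff' ℂ _ _ hp₁ hp₂).2 ?_)
    by_cases h1 : p₂ 0 = 0
    · have h2 : p₂ 1 ≠ 0 := fun h2 => hp₂ (by ext i; fin_cases i; exacts [h1, h2])
      rw [h1, mul_zero, sub_zero] at h0
      have h3 := (mul_eq_zero.1 h0).resolve_right h2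
      refine ⟨A * q 1 / p₂ 1, ?_⟩
      ext i
      fin_cases i
      · simp [h1, h3]
      · simp
        field_simp
    · refine ⟨A * q 0 / p₂ 0, ?_⟩
      ext i
      fin_cases i
      · simp
        field_simp
      · simp
        field_simp
        linear_combination h0
  refine ⟨hdet, hglue, fun h0 => ?_⟩
  obtain ⟨t, ht⟩ := hf0
  refine ht ?_
  have h1 : form f q p₂ = 0 := (hglue p₂).trans h0
  have h2 : form f q q = 0 := (hglue q).trans h1
  have h3 := bil_expand f 1 0 (fstCoord q p₂ t) (sndCoord q p₂ t) q p₂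
  rw [← eq_coord hdet, one_smul, zero_smul, add_zero] at h3
  simp only [← form_eq_bil] at h3
  rw [form_smul_left, h3, h1, h2]
  simp

/-- The witnesses are, up to scale, the coordinates `u` and `m`: the first vanishes on both lines,
the second jumps by one. -/
theorem Frame.exists_potentials {f : Matrix (Fin 2) (Fin 2) ℂ} {q p : Vec} (F : Frame f q p) :
    ∃ (f₁ f₂ : Matrix (Fin 2) (Fin 2) ℂ) (c₁ c₂ : ℂ), IsPotAt f q p f₁ c₁ ∧ IsPotAt f q p f₂ c₂ ∧
      LinearIndependent ℂ ![f₁, f₂, f] := by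
  obtain ⟨B, hB1, hB2, hB3, hB4⟩ := exists_bil_eq F.det_ne (0 : ℂ) 0 1 0
  obtain ⟨B', hB1', hB2', hB3', hB4'⟩ :=
    exists_bil_eq F.det_ne (2 * form f p p) (form f p p) 0 0
  simp only [← form_eq_bil] at hB1 hB2 hB3 hB4 hB1' hB2' hB3' hB4'
  refine ⟨B, B', 0, 1, ⟨by rw [hB1, hB2]; ring, by rw [hB2, hB4]; ring⟩,
    ⟨by rw [hB1', hB2']; ring, by rw [hB2', hB4']; ring⟩, ?_⟩
  rw [Fintype.linearIndependent_iff]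
  intro a ha
  have hadd : ∀ v w, a 0 * form B v w + a 1 * form B' v w + a 2 * form f v w = 0 := by
    intro v w
    have h0 : form (a 0 • B + a 1 • B' + a 2 • f) v w = 0 := by
      have : a 0 • B + a 1 • B' + a 2 • f = 0 := by simpa [Fin.sum_univ_three] using ha
      rw [this]
      simp [form]
    rw [← h0]
    simp only [form, Fin.sum_univ_two, Matrix.add_apply, Matrix.smul_apply, smul_eq_mul]
    ring
  have hpp := hadd p p
  have hqp := hadd q p
  have hpq := hadd p q
  have h2 : a 2 = 0 := by
    rw [hB4, hB4'] at hpp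
    simpa [F.ne] using hpp
  have h1 : a 1 = 0 := by
    rw [hB2, hB2', h2] at hqp
    simpa [F.ne] using hqp
  have h0 : a 0 = 0 := by
    rw [hB3, h1, h2] at hpq
    simpa using hpq
  intro i
  fin_cases i
  exacts [h0, h1, h2]

end BakerAkhiezer

end

/-! ### The main theorem -/

open BakerAkhiezer
theorem theorem1
    (p₁ p₂ : Fin 2 → ℂ) (hp₁ : p₁ ≠ 0) (hp₂ : p₂ ≠ 0)
    (hp : Projectivization.mk ℂ p₁ hp₁ ≠ Projectivization.mk ℂ p₂ hp₂)
    (f : Matrix (Fin 2) (Fin 2) ℂ) (A : ℂ) (hA : A ≠ 0)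
    (hf : ∀ t : Fin 2 → ℂ, form f p₁ t - A * form f t p₂ = 0)
    (hf0 : ∃ t : Fin 2 → ℂ, form f p₁ t ≠ 0) :
    (∃ (f₁ f₂ : Matrix (Fin 2) (Fin 2) ℂ) (c₁ c₂ : ℂ),
      IsPotential p₁ p₂ f f₁ c₁ ∧ IsPotential p₁ p₂ f f₂ c₂ ∧
      LinearIndependent ℂ ![f₁, f₂, f]) ∧
    ∀ (f₁ f₂ : Matrix (Fin 2) (Fin 2) ℂ) (c₁ c₂ Lam : ℂ),
      IsPotential p₁ p₂ f f₁ c₁ → IsPotential p₁ p₂ f f₂ c₂ →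
      LinearIndependent ℂ ![f₁, f₂, f] →
      ∀ U : TopologicalSpace.Opens (ℂ × ℂ), IsConnected (U : Set (ℂ × ℂ)) →
        (∃ h : Fin 2 → Matrix (Fin 2) (Fin 2) (holo U),
          (∀ k, IsBAFunction p₁ p₂ f f₁ f₂ Lam (h k)) ∧ ∀ q : U, IndepAt f f₁ f₂ h q) ∧
        ∀ h : Fin 2 → Matrix (Fin 2) (Fin 2) (holo U),
          (∀ k, IsBAFunction p₁ p₂ f f₁ f₂ Lam (h k)) →
          LinearIndependent (holo U) (fun k => psi f f₁ f₂ (h k)) →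
          IsOpen (regularLocus f f₁ f₂ c₁ c₂ Lam h) ∧ Dense (regularLocus f f₁ f₂ c₁ c₂ Lam h) ∧
          ∀ (W : TopologicalSpace.Opens (ℂ × ℂ)) (hWU : W ≤ U), (W : Set (ℂ × ℂ)).Nonempty →
            (∀ (q : ℂ × ℂ) (hq : q ∈ W), ⟨q, hWU hq⟩ ∈ regularLocus f f₁ f₂ c₁ c₂ Lam h) →
            ∃ D : meroRing (Projectivization.mk ℂ p₁ hp₁) (Projectivization.mk ℂ p₂ hp₂) f →+*
                Matrix (Fin 2) (Fin 2) (diffOp W),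
              Function.Injective D ∧
              (∀ lam, IsEigen _ _ f f₁ f₂ (fun k => (h k).map (holo.res hWU)) lam (D lam)) ∧
              (∀ lam (B : Matrix (Fin 2) (Fin 2) (diffOp W)),
                IsEigen _ _ f f₁ f₂ (fun k => (h k).map (holo.res hWU)) lam B → B = D lam) ∧
              ∀ lam mu, Commute (D lam) (D mu) := by
  obtain ⟨q, rfl⟩ : ∃ q, p₁ = A • q := ⟨A⁻¹ • p₁, (smul_inv_smul₀ hA p₁).symm⟩
  have F := frame_of_gluing hA hp₁ hp₂ hp hf hf0
  refine ⟨?_, ?_⟩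
  · obtain ⟨f₁, f₂, c₁, c₂, h₁, h₂, hli⟩ := F.exists_potentials
    exact ⟨f₁, f₂, c₁, c₂, F.isPotential hA h₁, F.isPotential hA h₂, hli⟩
  · intro f₁ f₂ c₁ c₂ Lam h₁ h₂ hli U hU
    have h₁ := F.isPotAt hA h₁
    have h₂ := F.isPotAt hA h₂
    have hΔ := F.discr_ne_zero h₁ h₂ hli
    refine ⟨?_, ?_⟩
    · obtain ⟨h, hh, hcoord⟩ := F.exists_numerators (U := U) (c₁, c₂) Lam
      refine ⟨h, F.isBAFunction h₁ h₂ hA hh, fun z => ?_⟩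
      rw [F.indepAt_iff h₁ h₂ hh, hcoord, Matrix.det_one, map_one]
      exact one_ne_zero
    · intro h hBA hψ
      have hh := fun k => F.isBAAt h₁ h₂ hA (hBA k)
      have hdet := F.det_coordMat_ne_zero hU.nonempty h₁ h₂ hh hψ
      have hε := mult_sub_one_ne_zero (Lam := Lam) hU.nonempty hΔ
      have hlocus := F.regularLocus_eq h₁ h₂ hh
      have hopen : ∀ g : holo U, IsOpen {z | holo.ev z g ≠ 0} := fun g =>
        isOpen_ne_fun (continuous_ev g) continuous_const
      refine ⟨?_, ?_, ?_⟩
      · rw [hlocus]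
        exact (hopen _).inter (hopen _)
      · rw [hlocus]
        -- Both conditions are non-vanishing of a nonzero analytic function on the connected set
        -- `U`, so each locus is open and dense.
        exact (dense_ev_ne_zero hU hε).inter_of_isOpen_left (dense_ev_ne_zero hU hdet) (hopen _)
      · intro W hWU hW hreg
        rw [hlocus] at hreg
        have hmk : Projectivization.mk ℂ (A • q) hp₁ =
            Projectivization.mk ℂ q (right_ne_zero_of_smul hp₁) :=
          (Projectivization.mk_eq_mk_iff' ℂ _ _ _ _).2 ⟨A, rfl⟩
        rw [hmk]
        refine F.exists_ringHom h₁ h₂ hli hW (fun k => (hh k).res hWU) ?_ ?_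
        · rw [Matrix.isUnit_iff_isUnit_det]
          refine isUnit_of_ev_ne_zero fun z => ?_
          rw [ev_det_coordMat_res]
          exact (hreg z.1 z.2).2
        · refine isUnit_of_ev_ne_zero fun z => ?_
          have := (hreg z.1 z.2).1
          rw [Set.mem_ofPred_eq, map_sub, map_one] at this
          rwa [map_sub, map_one, ev_mult_res hWU]
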